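/- **Setting.** Let $X_1,X_2,\ldots$ be i.i.d. with probability mass function $p(x)$ on a finite set $\mathcal X$, let $d:\mathcal X\times\hat{\mathcal X}\to[0,\infty]$ be a distortion function, and let $p(v,z|u)$ be a discrete memoryless wiretap channel with finite alphabets $\mathcal U,\mathcal V,\mathcal Z$ ($V$ is received by the legitimate receiver, $Z$ by the eavesdropper). Logarithms are in base 2. Put $$C=\max_{p(u)} I(U;V),\qquad C_{\mathrm{WT}}=\max_{p(w,u)}\big[I(W;V)-I(W;Z)\big],$$ where $W\to U\to(V,Z)$ is a Markov chain and $W$ has a finite alphabet. Let $R(D)=\inf I(X;\hat X)$ over the test channels $p(\hat x|x)$ with $\mathbb E\,d(X,\hat X)\le D$ be the rate-distortion function, and let $D(R)=\inf\{D: R(D)\le R\}$ be the distortion-rate function; assume that $\sup_{R\ge 0}D(R)<\infty$. A *regular cumulative function* is a non-decreasing function $F:[0,1]\to[0,\infty)$ with $F(0)=0$ that is right-continuous on $[0,1)$. Let $G$ (the cumulative rate distribution function, CRDF) and $L$ (the cumulative leakage function, CLDF) be regular cumulative functions. For $k,n\ge1$ let $r_i=G(\tfrac ik)-G(\tfrac{i-1}k)$,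 $m_0=0$ and $m_i=m_{i-1}+\lfloor nkr_i\rfloor$ for $1\le i\le k$. A $(G,k,n)$-code consists of encoders $\varphi_i:\mathcal X^{in}\to\mathcal U^{m_i-m_{i-1}}$, $1\le i\le k$, where $\varphi_i$ maps $X^{in}$ to the channel inputs $U_{m_{i-1}+1}^{m_i}$, and a decoder $\psi:\mathcal V^{m_k}\to\hat{\mathcal X}^{nk}$, $\hat X^{nk}=\psi(V^{m_k})$. The CRDF $G$ is *achievable* given $L$ with distortion level $\bar d$ if for every $k\ge 1$ there are $(G,k,n)$-codes, $n=1,2,\ldots$, such that $$\limsup_{n\to\infty}\mathbb E\Big[\frac1{nk}\sum_{t=1}^{nk}d(X_t,\hat X_t)\Big]\le\bar d,\qquad \frac1{nk}I(X^{in};Z^{m_i})\le L(\tfrac ik)\quad\text{for all } n\ge 1 \text{ and } 1\le i\le k.$$ **Theorem.** Define $G^{\mathrm{eff}}_{\mathrm{out}}:[0,1]\to[0,\infty)$ by $$G^{\mathrm{eff}}_{\mathrm{out}}(\alpha)=\max\Big\{C_{\mathrm{WT}}\,G(\alpha),\; C\,G(\alpha)-\sup_{\beta\in[0,1]}\big((C-C_{\mathrm{WT}})G(\beta)-L(\beta)\big)\Big\}.$$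 If $G$ is achievable given $L$ with distortion level $\bar d$, then $G^{\mathrm{eff}}_{\mathrm{out}}$ has a concave envelope $\hat G^{\mathrm{eff}}_{\mathrm{out}}$ on $[0,1]$ (the least concave function on $[0,1]$ that is at least $G^{\mathrm{eff}}_{\mathrm{out}}$), it is differentiable with non-negative derivative almost everywhere on $[0,1]$, and $$\int_0^1 D\Big(\frac{\mathrm d\hat G^{\mathrm{eff}}_{\mathrm{out}}}{\mathrm d\alpha}(\alpha)\Big)\,\mathrm d\alpha\le\bar d .$$ -/

import Mathlib

open scoped ENNReal

namespace SeqJSC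

noncomputable section

/-! ### Finite probability: laws and mutual information

A probability mass function on a finite type `Ω` is a function `P : Ω → ℝ` with
`P ∈ stdSimplex ℝ Ω`; a random variable is a function on `Ω`. -/

open Classical in
/-- The probability mass function of the random variable `f` under `P`:
`law P f b = P{f = b}`. -/
def law {Ω β : Type*} [Fintype Ω] (P : Ω → ℝ) (f : Ω → β) (b : β) : ℝ :=
  ∑ ω, if f ω = b then P ω else 0

/-- The mutual information `I(f; g)`, in bits, of two random variables with finitely many values.
(A term with `P{f = a, g = b} = 0` is `0`, which is the usual convention.) -/
def mutualInfo {Ω α β : Type*} [Fintype Ω] [Fintype α] [Fintype β]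
    (P : Ω → ℝ) (f : Ω → α) (g : Ω → β) : ℝ :=
  ∑ a, ∑ b, law P (fun ω => (f ω, g ω)) (a, b) *
    Real.logb 2 (law P (fun ω => (f ω, g ω)) (a, b) / (law P f a * law P g b))

/-! ### Regular cumulative functions -/

/-- A regular cumulative function `F : [0,1] → [0,∞)`: non-decreasing, `F 0 = 0`, and continuous
from the right on `[0,1)`. Values of `F` outside `[0,1]` are irrelevant. -/
structure IsRegularCumulative (F : ℝ → ℝ) : Prop where
  nonneg : ∀ α ∈ Set.Icc (0 : ℝ) 1, 0 ≤ F α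
  mono : MonotoneOn F (Set.Icc 0 1)
  zero : F 0 = 0
  right_cont : ∀ α ∈ Set.Ico (0 : ℝ) 1, ContinuousWithinAt F (Set.Ioi α) α

/-- Cumulative rate distribution functions. -/
abbrev IsCRDF (G : ℝ → ℝ) : Prop := IsRegularCumulative G

/-- Cumulative leakage functions. -/
abbrev IsCLDF (L : ℝ → ℝ) : Prop := IsRegularCumulative L

/-! ### The wiretap channel

A wiretap channel is a conditional probability mass function `K u (v, z) = p(v, z | u)`. -/

/-- `K u` is a probability mass function on `V × Z` for every input `u`. -/
def IsWiretapChannel {U V Z : Type*} [Fintype V] [Fintype Z] (K : U → V × Z → ℝ) : Prop :=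
  ∀ u, K u ∈ stdSimplex ℝ (V × Z)

/-- The capacity `C = max_{p(u)} I(U; V)` of the channel `p(v | u)` to the legitimate receiver. -/
def capacity {U V Z : Type*} [Fintype U] [Fintype V] [Fintype Z] (K : U → V × Z → ℝ) : ℝ :=
  sSup {r : ℝ | ∃ q ∈ stdSimplex ℝ U,
    r = mutualInfo (fun ω : U × V × Z => q ω.1 * K ω.1 ω.2) (fun ω => ω.1) (fun ω => ω.2.1)}

/-- The joint probability mass function of `(W, U, V, Z)` when `(W, U)` has the probability mass
function `q` and `W → U → (V, Z)` is a Markov chain with transition `p(v, z | u)`. -/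
def auxLaw {A U V Z : Type*} (K : U → V × Z → ℝ) (q : A × U → ℝ) (ω : A × U × V × Z) : ℝ :=
  q (ω.1, ω.2.1) * K ω.2.1 ω.2.2

/-- The secrecy capacity `C_WT = max_{p(w,u)} I(W; V) - I(W; Z)`, where the auxiliary random
variable `W` has an arbitrary finite alphabet. -/
def secrecyCapacity {U V Z : Type*} [Fintype U] [Fintype V] [Fintype Z]
    (K : U → V × Z → ℝ) : ℝ :=
  sSup {r : ℝ | ∃ a : ℕ, ∃ q ∈ stdSimplex ℝ (Fin a × U),
    r = mutualInfo (auxLaw K q) (fun ω => ω.1) (fun ω => ω.2.2.1)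
      - mutualInfo (auxLaw K q) (fun ω => ω.1) (fun ω => ω.2.2.2)}

/-! ### Rate-distortion and distortion-rate functions -/

/-- The rate-distortion function `R(D) = min I(X; X̂)`, in bits, over the test channels `p(x̂ | x)`
with `E d(X, X̂) ≤ D` (and `∞` if there are none). Test channels are supported on a finite subset of
the reconstruction alphabet, which is no restriction when that alphabet is finite. -/
def rateDistortion {X Y : Type*} [Fintype X] (p : X → ℝ) (d : X → Y → ℝ≥0∞) (D : ℝ≥0∞) : ℝ≥0∞ :=
  ⨅ (S : Finset Y) (Q : X → S → ℝ) (_ : ∀ x, Q x ∈ stdSimplex ℝ S)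
    (_ : ∑ x, ∑ y : S, ENNReal.ofReal (p x * Q x y) * d x y ≤ D),
    ENNReal.ofReal (mutualInfo (fun ω : X × S => p ω.1 * Q ω.1 ω.2) Prod.fst Prod.snd)

/-- The distortion-rate function, the inverse of the non-increasing function `R(D)`:
the smallest distortion that needs a rate of at most `R`. -/
def distortionRate {X Y : Type*} [Fintype X] (p : X → ℝ) (d : X → Y → ℝ≥0∞) (R : ℝ≥0∞) : ℝ≥0∞ :=
  sInf {D : ℝ≥0∞ | rateDistortion p d D ≤ R}

/-! ### Sequential source-channel codes

The `n k` source symbols are indexed by pairs of a block in `Fin k` and a position in `Fin n`.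
The block `i : Fin k` is the `(i + 1)`-st one. -/

/-- The number `⌊n k r⌋`, `r = G((i+1)/k) - G(i/k)`, of channel uses in the block `i`. -/
def blockLen (G : ℝ → ℝ) (k n : ℕ) (i : Fin k) : ℕ :=
  ⌊(n : ℝ) * k * (G (((i : ℕ) + 1 : ℝ) / k) - G (((i : ℕ) : ℝ) / k))⌋₊

/-- Sequences of letters of `A` over all channel uses of all `k` blocks. -/
abbrev ChannelSeq (G : ℝ → ℝ) (k n : ℕ) (A : Type*) : Type _ :=
  (i : Fin k) → Fin (blockLen G k n i) → A

/-- A `(G, k, n)` source-channel code: the encoder of a block maps the source symbols of this and of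
all the earlier blocks to the channel inputs of the block; the decoder maps the whole sequence of
channel outputs to the reconstruction. -/
structure Code (X Y U V : Type*) (G : ℝ → ℝ) (k n : ℕ) where
  enc : (i : Fin k) → ({j : Fin k // j ≤ i} → Fin n → X) → Fin (blockLen G k n i) → U
  dec : ChannelSeq G k n V → Fin k → Fin n → Y

namespace Code

variable {X Y U V Z : Type*} {G : ℝ → ℝ} {k n : ℕ}

/-- The joint probability mass function of the i.i.d. source block and of the outputs of the
memoryless wiretap channel at the two receivers. -/
def jointLaw (c : Code X Y U V G k n) (p : X → ℝ) (K : U → V × Z → ℝ)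
    (ω : (Fin k → Fin n → X) × ChannelSeq G k n (V × Z)) : ℝ :=
  (∏ i, ∏ t, p (ω.1 i t)) * ∏ i, ∏ t, K (c.enc i (fun j => ω.1 j) t) (ω.2 i t)

/-- The expected distortion `E d(X^{nk}, X̂^{nk})`, where the distortion of a sequence is the average
of the distortions of its `n k` symbols. -/
def expectedDistortion [Fintype X] [Fintype V] [Fintype Z] (c : Code X Y U V G k n) (p : X → ℝ)
    (K : U → V × Z → ℝ) (d : X → Y → ℝ≥0∞) : ℝ≥0∞ :=
  ∑ ω : (Fin k → Fin n → X) × ChannelSeq G k n (V × Z), ENNReal.ofReal (c.jointLaw p K ω) *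
    (((n : ℝ≥0∞) * k)⁻¹ * ∑ i, ∑ t, d (ω.1 i t) (c.dec (fun j s => (ω.2 j s).1) i t))

/-- The information, in bits, that the outputs at the eavesdropper up to the end of the block `i`
contain about the source symbols of the blocks up to `i`. -/
def leakage [Fintype X] [Fintype V] [Fintype Z] (c : Code X Y U V G k n) (p : X → ℝ)
    (K : U → V × Z → ℝ) (i : Fin k) : ℝ :=
  mutualInfo (c.jointLaw p K)
    (fun ω (j : {j : Fin k // j ≤ i}) => ω.1 j)
    (fun ω (j : {j : Fin k // j ≤ i}) (s : Fin (blockLen G k n j)) => (ω.2 j s).2)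

end Code

/-- `G` is achievable given `L` with distortion level `dbar`, for the i.i.d. source `p`, the
distortion function `d` and the wiretap channel `K`. -/
def IsAchievable {X Y U V Z : Type*} [Fintype X] [Fintype V] [Fintype Z]
    (p : X → ℝ) (d : X → Y → ℝ≥0∞) (K : U → V × Z → ℝ)
    (G L : ℝ → ℝ) (dbar : ℝ≥0∞) : Prop :=
  ∀ k : ℕ, 1 ≤ k → ∃ c : (n : ℕ) → Code X Y U V G k n,
    Filter.limsup (fun n => (c n).expectedDistortion p K d) Filter.atTop ≤ dbar ∧
    ∀ n : ℕ, 1 ≤ n → ∀ i : Fin k,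
      1 / ((n : ℝ) * k) * (c n).leakage p K i ≤ L (((i : ℕ) + 1 : ℝ) / k)

/-! ### The effective rate profile and concave envelopes -/

/-- The effective rate profile
`max {C_WT G(α), C G(α) - sup_{β ∈ [0,1]} ((C - C_WT) G(β) - L(β))}`. -/
def effOut {U V Z : Type*} [Fintype U] [Fintype V] [Fintype Z] (K : U → V × Z → ℝ)
    (G L : ℝ → ℝ) (α : ℝ) : ℝ :=
  max (secrecyCapacity K * G α)
    (capacity K * G α -
      sSup ((fun β => (capacity K - secrecyCapacity K) * G β - L β) '' Set.Icc (0 : ℝ) 1))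

/-- `g` is the concave envelope of `f` on `s`: the least concave function on `s` above `f`. -/
structure IsConcaveEnvelopeOn (s : Set ℝ) (f g : ℝ → ℝ) : Prop where
  concave : ConcaveOn ℝ s g
  le : ∀ x ∈ s, f x ≤ g x
  least : ∀ h : ℝ → ℝ, ConcaveOn ℝ s h → (∀ x ∈ s, f x ≤ h x) → ∀ x ∈ s, g x ≤ h x

end

end SeqJSC

namespace SeqJSC

open Finset

/-! ### Entropy calculus on finite probability spaces. -/

section Entropy

variable {Ω α β γ δ : Type*} [Fintype Ω] {P : Ω → ℝ}

/-! For a fixed code, let R be the rate of a source letter, that is, the information I(X; X̂)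
between the letter and its reconstruction (`Code.letterRate`). The expected distortion of the letter
is at least D(R), so the average of D over the letter rates bounds the distortion of the code from
below. It remains to compare the letter rates with the slope of the concave envelope g of E =
`effOut`, by a majorization argument.

The converse (`sum_letterRate_le_effOut`) says that, for a secret code with n k letters on a fine
grid, the rates of the letters after a fraction α = m/k of the source add up to at most n k (E(1) -
E(α)), up to a small error. Since the letters are independent, these rates add up to at most I(X; V
| A), where A consists of the earlier letters. The legitimate outputs are now replaced one channel
use at a time: turning V into a constant lowers the information by at most C, turning V into Z
lowers it by at most C_WT, and a channel use whose input is determined by A contributes nothing. If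
Z is kept up to time β, what remains is at most the leakage, hence at most n k L(β). Taking β nearly
optimal produces the supremum in E; replacing every V by a constant gives the bound C (G(1) - G(α)).
The two bounds match the two branches of the maximum in E(α).

For the comparison (`IsConcaveEnvelopeOn.exists_hinge_le`, `hinge_le_avgRate`), let α maximize E(x)
- s x. There g touches E, and its slope is at least s before α and at most s after it. Hence the
integral of (s - g')⁺ is at most s (1 - α) - (E(1) - E(α)), while the tail bound makes the average
of (s - R)⁺ at least this much, up to a small error. A non-increasing convex function is, up to a
small error, a constant plus a positive combination of such hinges (`exists_hinge_approx`). So the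
integral of D(g') is at most the average of D(R), again up to an error. The approximation costs a
shift h of the rate, which is removed at the end by right-continuity of D and monotone convergence.
-/

theorem law_nonneg (hP : ∀ ω, 0 ≤ P ω) (f : Ω → β) (b : β) : 0 ≤ law P f b :=
  sum_nonneg fun ω _ => by split_ifs <;> simp [hP]

theorem le_law_self (hP : ∀ ω, 0 ≤ P ω) (f : Ω → β) (ω : Ω) : P ω ≤ law P f (f ω) := by
  classical
  unfold law
  refine le_trans ?_ (single_le_sum (f := fun ω' => if f ω' = f ω then P ω' else 0)
    (fun ω' _ => by split_ifs <;> simp [hP]) (mem_univ ω))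
  simp

theorem sum_law_mul [Fintype β] (P : Ω → ℝ) (f : Ω → β) (F : β → ℝ) :
    ∑ b, law P f b * F b = ∑ ω, P ω * F (f ω) := by
  classical
  simp only [law, sum_mul]
  rw [sum_comm]
  refine sum_congr rfl fun ω _ => ?_
  simp [ite_mul]

theorem sum_law [Fintype β] (P : Ω → ℝ) (f : Ω → β) : ∑ b, law P f b = ∑ ω, P ω := by
  simpa using sum_law_mul P f (fun _ => 1)

theorem law_comp [Fintype β] (P : Ω → ℝ) (f : Ω → β) (φ : β → γ) (c : γ) :
    law P (fun ω => φ (f ω)) c = law (law P f) φ c := by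
  classical
  have := sum_law_mul P f (fun b => if φ b = c then 1 else 0)
  simp only [mul_ite, mul_one, mul_zero] at this
  exact this.symm

theorem sum_law_left [Fintype α] (P : Ω → ℝ) (f : Ω → α) (g : Ω → β) (b : β) :
    ∑ a, law P (fun ω => (f ω, g ω)) (a, b) = law P g b := by
  classical
  simp only [law]
  rw [sum_comm]
  refine sum_congr rfl fun ω _ => ?_
  by_cases h : g ω = b <;> simp [Prod.ext_iff, h]

theorem law_equiv {Ω' : Type*} [Fintype Ω'] (e : Ω' ≃ Ω) (f : Ω → β) (b : β) :
    law (fun ω => P (e ω)) (fun ω => f (e ω)) b = law P f b := by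
  classical
  exact e.sum_comp (fun ω => if f ω = b then P ω else 0)

/-- The entropy, in nats, of a random variable on a finite probability space. -/
noncomputable def entropy (P : Ω → ℝ) (f : Ω → β) : ℝ :=
  -∑ ω, P ω * Real.log (law P f (f ω))

/-- Entropy sees only the partition into fibres. Every re-encoding of random variables thus reduces
to a logical equivalence, and value types need not be finite. -/
theorem entropy_congr {f : Ω → β} {g : Ω → γ} (h : ∀ ω ω', f ω = f ω' ↔ g ω = g ω') :
    entropy P f = entropy P g := by
  have : ∀ ω, law P f (f ω) = law P g (g ω) := fun ω => by
    classical
    exact sum_congr rfl fun ω' _ => if_congr (h ω' ω) rfl rfl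
  simp only [entropy, this]

theorem entropy_equiv {Ω' : Type*} [Fintype Ω'] (e : Ω' ≃ Ω) (f : Ω → β) :
    entropy (fun ω => P (e ω)) (fun ω => f (e ω)) = entropy P f := by
  unfold entropy
  simp only [law_equiv]
  rw [e.sum_comp (fun ω => P ω * Real.log (law P f (f ω)))]

theorem entropy_eq_sum [Fintype β] (P : Ω → ℝ) (f : Ω → β) :
    entropy P f = -∑ b, law P f b * Real.log (law P f b) := by
  rw [sum_law_mul P f (fun b => Real.log (law P f b))]; rfl

theorem mutualInfo_eq [Fintype α] [Fintype β] (hP : ∀ ω, 0 ≤ P ω) (f : Ω → α) (g : Ω → β) :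
    mutualInfo P f g =
      (entropy P f + entropy P g - entropy P (fun ω => (f ω, g ω))) / Real.log 2 := by
  have h1 : mutualInfo P f g = ∑ c : α × β, law P (fun ω => (f ω, g ω)) c *
      Real.logb 2 (law P (fun ω => (f ω, g ω)) c / (law P f c.1 * law P g c.2)) := by
    rw [Fintype.sum_prod_type]; rfl
  rw [h1, sum_law_mul P (fun ω => (f ω, g ω)) (fun c =>
    Real.logb 2 (law P (fun ω => (f ω, g ω)) c / (law P f c.1 * law P g c.2)))]
  rw [eq_div_iff (by positivity), sum_mul]
  simp only [entropy]
  rw [← sum_neg_distrib, ← sum_neg_distrib, ← sum_add_distrib, ← sum_neg_distrib,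
    ← sum_sub_distrib]
  refine sum_congr rfl fun ω _ => ?_
  rcases (hP ω).eq_or_lt with h | h
  · simp [← h]
  have a1 := h.trans_le (le_law_self hP f ω)
  have a2 := h.trans_le (le_law_self hP g ω)
  have a3 := h.trans_le (le_law_self hP (fun ω => (f ω, g ω)) ω)
  rw [Real.logb, Real.log_div a3.ne' (by positivity), Real.log_mul a1.ne' a2.ne']
  field_simp
  ring

/-- Conditional mutual information is non-negative: apply log r ≤ r - 1 to r = p(f,h) p(g,h) /
(p(f,g,h) p(h)), whose expectation is at most 1. -/
theorem entropy_submodular_of_fintype [Fintype α] [Fintype β] [Fintype γ] (hP : ∀ ω, 0 ≤ P ω)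
    (f : Ω → α) (g : Ω → β) (h : Ω → γ) :
    entropy P (fun ω => (f ω, g ω, h ω)) + entropy P h ≤
      entropy P (fun ω => (f ω, h ω)) + entropy P (fun ω => (g ω, h ω)) := by
  set p3 := law P (fun ω => (f ω, g ω, h ω)) with hp3
  set pf := law P (fun ω => (f ω, h ω)) with hpf
  set pg := law P (fun ω => (g ω, h ω)) with hpg
  set ph := law P h with hph
  have n3 : ∀ c, 0 ≤ p3 c := law_nonneg hP _
  have nf : ∀ c, 0 ≤ pf c := law_nonneg hP _
  have ng : ∀ c, 0 ≤ pg c := law_nonneg hP _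
  have nh : ∀ c, 0 ≤ ph c := law_nonneg hP _
  let r : α × β × γ → ℝ := fun c => pf (c.1, c.2.2) * pg c.2 / (p3 c * ph c.2.2)
  have key : ∑ ω, P ω * r (f ω, g ω, h ω) ≤ ∑ ω, P ω := by
    rw [← sum_law_mul P (fun ω => (f ω, g ω, h ω)) r]
    calc ∑ c, p3 c * r c ≤ ∑ c : α × β × γ, pf (c.1, c.2.2) * pg c.2 / ph c.2.2 := by
          refine sum_le_sum fun c _ => ?_
          rcases (n3 c).eq_or_lt with h0 | h0
          · rw [← h0, zero_mul]
            exact div_nonneg (mul_nonneg (nf _) (ng _)) (nh _)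
          · apply le_of_eq
            simp only [r]
            rw [mul_comm (p3 c) (ph _), ← div_div, mul_div_cancel₀ _ h0.ne']
      _ = ∑ c, (∑ a, pf (a, c)) * (∑ b, pg (b, c)) / ph c := by
          simp only [Fintype.sum_prod_type, sum_mul_sum, sum_div]
          rw [sum_comm (s := (univ : Finset γ))]
          exact sum_congr rfl fun a _ => sum_comm
      _ = ∑ c, ph c := by
          refine sum_congr rfl fun c _ => ?_
          rw [hpf, hpg, sum_law_left, sum_law_left, mul_self_div_self]
      _ = ∑ ω, P ω := sum_law P h
  have : 0 ≤ ∑ ω, P ω * (Real.log (p3 (f ω, g ω, h ω)) + Real.log (ph (h ω))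
      - Real.log (pf (f ω, h ω)) - Real.log (pg (g ω, h ω))) := by
    have h2 : ∑ ω, P ω * (1 - r (f ω, g ω, h ω)) ≤ ∑ ω, P ω * (Real.log (p3 (f ω, g ω, h ω)) +
        Real.log (ph (h ω)) - Real.log (pf (f ω, h ω)) - Real.log (pg (g ω, h ω))) := by
      refine sum_le_sum fun ω _ => ?_
      rcases (hP ω).eq_or_lt with h0 | h0
      · simp [← h0]
      have a3 : 0 < p3 (f ω, g ω, h ω) := h0.trans_le (le_law_self hP (fun ω => (f ω, g ω, h ω)) ω)
      have af : 0 < pf (f ω, h ω) := h0.trans_le (le_law_self hP (fun ω => (f ω, h ω)) ω)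
      have ag : 0 < pg (g ω, h ω) := h0.trans_le (le_law_self hP (fun ω => (g ω, h ω)) ω)
      have ah : 0 < ph (h ω) := h0.trans_le (le_law_self hP h ω)
      refine mul_le_mul_of_nonneg_left ?_ h0.le
      have hr : 0 < r (f ω, g ω, h ω) := by simp only [r]; positivity
      have := Real.log_le_sub_one_of_pos hr
      simp only [r] at this ⊢
      rw [Real.log_div (by positivity) (by positivity), Real.log_mul af.ne' ag.ne',
        Real.log_mul a3.ne' ah.ne'] at this
      linarith
    refine le_trans ?_ h2
    simp only [mul_sub, mul_one, sum_sub_distrib]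
    linarith
  simp only [mul_sub, mul_add, sum_sub_distrib, sum_add_distrib] at this
  simp only [entropy]
  linarith

omit [Fintype Ω] in
theorem fiber_eq_iff (φ : Ω → β) (ω ω' : Ω) :
    ({x | φ x = φ ω} : Set Ω) = {x | φ x = φ ω'} ↔ φ ω = φ ω' := by
  refine ⟨fun h => ?_, fun h => by simp [h]⟩
  have : ω ∈ ({x | φ x = φ ω'} : Set Ω) := h ▸ (by simp)
  exact this

theorem entropy_submodular (hP : ∀ ω, 0 ≤ P ω) (f : Ω → α) (g : Ω → β) (h : Ω → γ) :
    entropy P (fun ω => (f ω, g ω, h ω)) + entropy P h ≤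
      entropy P (fun ω => (f ω, h ω)) + entropy P (fun ω => (g ω, h ω)) := by
  classical
  -- Passing from values to fibres makes the value types finite and leaves all entropies unchanged.
  have := entropy_submodular_of_fintype hP (fun ω => ({x | f x = f ω} : Set Ω))
    (fun ω => ({x | g x = g ω} : Set Ω)) (fun ω => ({x | h x = h ω} : Set Ω))
  have e1 := entropy_congr (P := P) (f := fun ω => (f ω, g ω, h ω)) (g := fun ω =>
    (({x | f x = f ω} : Set Ω), ({x | g x = g ω} : Set Ω), ({x | h x = h ω} : Set Ω)))
    (by simp [fiber_eq_iff])
  have e2 := entropy_congr (P := P) (f := h) (g := fun ω => ({x | h x = h ω} : Set Ω))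
    (by simp [fiber_eq_iff])
  have e3 := entropy_congr (P := P) (f := fun ω => (f ω, h ω)) (g := fun ω =>
    (({x | f x = f ω} : Set Ω), ({x | h x = h ω} : Set Ω))) (by simp [fiber_eq_iff])
  have e4 := entropy_congr (P := P) (f := fun ω => (g ω, h ω)) (g := fun ω =>
    (({x | g x = g ω} : Set Ω), ({x | h x = h ω} : Set Ω))) (by simp [fiber_eq_iff])
  linarith

theorem entropy_le_prod (hP : ∀ ω, 0 ≤ P ω) (f : Ω → α) (g : Ω → β) :
    entropy P f ≤ entropy P (fun ω => (f ω, g ω)) := by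
  unfold entropy
  refine neg_le_neg (sum_le_sum fun ω _ => ?_)
  rcases (hP ω).eq_or_lt with h | h
  · simp [← h]
  refine mul_le_mul_of_nonneg_left (Real.log_le_log ?_ ?_) h.le
  · exact h.trans_le (le_law_self hP (fun ω => (f ω, g ω)) ω)
  · classical
    refine sum_le_sum fun ω' _ => ?_
    by_cases h1 : f ω' = f ω
    · by_cases h2 : g ω' = g ω <;> simp [h1, h2, hP]
    · simp [h1]

theorem entropy_const (hP : P ∈ stdSimplex ℝ Ω) (b : β) : entropy P (fun _ => b) = 0 := by
  have : law P (fun _ => b) b = 1 := by simp [law, hP.2]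
  simp [entropy, this]

/-- A crude bound by 1 for each value; it serves only to show that the set defining the capacity is
bounded above. -/
theorem entropy_le_card [Fintype β] (hP : ∀ ω, 0 ≤ P ω) (f : Ω → β) :
    entropy P f ≤ Fintype.card β := by
  rw [entropy_eq_sum, ← sum_neg_distrib]
  refine (sum_le_sum (g := fun _ => (1 : ℝ)) fun b _ => ?_).trans (by simp)
  rcases (law_nonneg hP f b).eq_or_lt with h | h
  · simp [← h]
  have := Real.log_le_sub_one_of_pos (inv_pos.2 h)
  rw [Real.log_inv] at this
  nlinarith [mul_inv_cancel₀ h.ne']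

theorem entropy_prod_le (hP : P ∈ stdSimplex ℝ Ω) (f : Ω → α) (g : Ω → β) :
    entropy P (fun ω => (f ω, g ω)) ≤ entropy P f + entropy P g := by
  have := entropy_submodular hP.1 f g (fun _ => ())
  have e1 := entropy_congr (P := P) (f := fun ω => (f ω, g ω)) (g := fun ω => (f ω, g ω, ()))
    (by simp)
  have e2 := entropy_congr (P := P) (f := f) (g := fun ω => (f ω, ())) (by simp)
  have e3 := entropy_congr (P := P) (f := g) (g := fun ω => (g ω, ())) (by simp)
  have e4 := entropy_const hP ()
  linarith

/-- If the conditional law of `g` given `f = a` is `k a`, then the conditional entropy of `g` given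
`f` is the expected value of `-log k`. -/
theorem entropy_sub_of_kernel (hP : ∀ ω, 0 ≤ P ω) (f : Ω → α) (g : Ω → β) (k : α → β → ℝ)
    (h : ∀ a b, law P (fun ω => (f ω, g ω)) (a, b) = law P f a * k a b) :
    entropy P (fun ω => (f ω, g ω)) - entropy P f = -∑ ω, P ω * Real.log (k (f ω) (g ω)) := by
  simp only [entropy]
  rw [neg_sub_neg, ← sum_sub_distrib, ← sum_neg_distrib]
  refine sum_congr rfl fun ω _ => ?_
  rcases (hP ω).eq_or_lt with h0 | h0
  · simp [← h0]
  have h1 := h0.trans_le (le_law_self hP f ω)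
  have h2 := h0.trans_le (le_law_self hP (fun ω => (f ω, g ω)) ω)
  simp only [h] at h2 ⊢
  rw [Real.log_mul h1.ne' (fun hk => by simp [hk] at h2)]
  ring

theorem sum_ite_const_zero {ι : Type*} [Fintype ι] (q : Prop) [Decidable q] (F : ι → ℝ) :
    ∑ i, (if q then F i else 0) = if q then ∑ i, F i else 0 := by
  split_ifs <;> simp

/-- Marginalizing a kernel. -/
theorem law_map_kernel [Fintype β] (f : Ω → α) (g : Ω → β) (k : α → β → ℝ)
    (h : ∀ a b, law P (fun ω => (f ω, g ω)) (a, b) = law P f a * k a b) (φ : β → γ) (a : α)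
    (c : γ) : law P (fun ω => (f ω, φ (g ω))) (a, c) = law P f a * law (k a) φ c := by
  classical
  have : law P (fun ω => (f ω, φ (g ω))) (a, c)
      = ∑ b, if φ b = c then law P (fun ω => (f ω, g ω)) (a, b) else 0 := by
    simp only [law, ← sum_ite_const_zero, Prod.mk.injEq]
    rw [sum_comm]
    refine sum_congr rfl fun ω _ => ?_
    rw [sum_eq_single (g ω)]
    · by_cases h1 : f ω = a <;> by_cases h2 : φ (g ω) = c <;> simp [h1, h2]
    · intro b _ hb
      simp [hb.symm]
    · simp
  rw [this]
  simp only [h]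
  simp only [law, mul_sum, mul_ite, mul_zero]

/-- Coarsening the conditioning variable of a kernel that depends only on the coarser one. -/
theorem law_coarsen_kernel [Fintype α] (f : Ω → α) (g : Ω → β) (u : α → γ) (k : γ → β → ℝ)
    (h : ∀ a b, law P (fun ω => (f ω, g ω)) (a, b) = law P f a * k (u a) b) (c : γ) (b : β) :
    law P (fun ω => (u (f ω), g ω)) (c, b) = law P (fun ω => u (f ω)) c * k c b := by
  classical
  have h1 : law P (fun ω => (u (f ω), g ω)) (c, b)
      = ∑ a, if u a = c then law P (fun ω => (f ω, g ω)) (a, b) else 0 := by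
    simp only [law, ← sum_ite_const_zero, Prod.mk.injEq]
    rw [sum_comm]
    refine sum_congr rfl fun ω _ => ?_
    rw [sum_eq_single (f ω)]
    · by_cases h1 : g ω = b <;> by_cases h2 : u (f ω) = c <;> simp [h1, h2]
    · intro b _ hb
      simp [hb.symm]
    · simp
  rw [h1, law_comp P f u]
  simp only [h]
  simp only [law.eq_1 (law P f), sum_mul, ite_mul, zero_mul]
  refine sum_congr rfl fun a _ => ?_
  split_ifs with hc
  · rw [hc]
  · rfl

/-- Chain rule: the average of entropies of conditional laws. -/
theorem sum_mul_entropy_eq [Fintype β] [Fintype γ] {Ω' : Type*} [Fintype Ω'] (hP : ∀ ω, 0 ≤ P ω)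
    (f : Ω → β) (t : Ω → γ) (P' : γ → Ω' → ℝ) (f' : Ω' → β)
    (h : ∀ b c, law P (fun ω => (f ω, t ω)) (b, c) = law P t c * law (P' c) f' b) :
    ∑ c, law P t c * entropy (P' c) f' = entropy P (fun ω => (f ω, t ω)) - entropy P t := by
  rw [entropy_eq_sum P (fun ω => (f ω, t ω)), entropy_eq_sum P t, Fintype.sum_prod_type, sum_comm,
    neg_sub_neg, ← sum_sub_distrib]
  refine sum_congr rfl fun c _ => ?_
  have e : law P t c * Real.log (law P t c)
      = ∑ b, law P (fun ω => (f ω, t ω)) (b, c) * Real.log (law P t c) := by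
    rw [← sum_mul, sum_law_left]
  rw [e, ← sum_sub_distrib, entropy_eq_sum, mul_neg, mul_sum, ← sum_neg_distrib]
  refine sum_congr rfl fun b _ => ?_
  rcases (law_nonneg hP (fun ω => (f ω, t ω)) (b, c)).eq_or_lt with h0 | h0
  · rw [← h0]
    rcases mul_eq_zero.1 (h0.trans (h b c)).symm with h1 | h1 <;> simp [h1]
  · rw [h] at h0 ⊢
    rw [Real.log_mul (fun hk => by simp [hk] at h0) (fun hk => by simp [hk] at h0)]
    ring

end Entropy
-- Single-letter bounds by the capacity and the secrecy capacity.
section SingleLetter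

variable {Ω α β γ δ τ : Type*} [Fintype Ω] {P : Ω → ℝ}

theorem law_eq_of_iff {f : Ω → β} {g : Ω → γ} {b : β} {c : γ} (h : ∀ ω, f ω = b ↔ g ω = c) :
    law P f b = law P g c := by
  classical
  exact sum_congr rfl fun ω _ => if_congr (h ω) rfl rfl

theorem entropy_comp_eq_of_law_eq {Ω' : Type*} [Fintype Ω'] [Fintype β] [Fintype γ] {P' : Ω' → ℝ}
    {f : Ω → β} {f' : Ω' → β} (h : ∀ b, law P f b = law P' f' b) (φ : β → γ) :
    entropy P (fun ω => φ (f ω)) = entropy P' (fun ω => φ (f' ω)) := by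
  simp only [entropy_eq_sum, law_comp P f φ, law_comp P' f' φ, funext h]

theorem entropy_eq_of_law_eq {Ω' : Type*} [Fintype Ω'] [Fintype β] {P' : Ω' → ℝ} {f : Ω → β}
    {f' : Ω' → β} (h : ∀ b, law P f b = law P' f' b) : entropy P f = entropy P' f' := by
  simp only [entropy_eq_sum, h]

theorem mutualInfo_nonneg [Fintype α] [Fintype β] (hP : P ∈ stdSimplex ℝ Ω) (f : Ω → α)
    (g : Ω → β) : 0 ≤ mutualInfo P f g := by
  rw [mutualInfo_eq hP.1]
  have := entropy_prod_le hP f g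
  have := Real.log_pos one_lt_two
  exact div_nonneg (by linarith) this.le

theorem mutualInfo_of_subsingleton [Fintype α] [Fintype β] [Subsingleton α]
    (hP : P ∈ stdSimplex ℝ Ω) (f : Ω → α) (g : Ω → β) : mutualInfo P f g = 0 := by
  have e1 := entropy_congr (P := P) (f := fun ω => (f ω, g ω)) (g := g)
    (fun ω ω' => by simp [Subsingleton.elim (f ω) (f ω')])
  have e2 := entropy_congr (P := P) (f := f) (g := fun _ => ())
    (fun ω ω' => by simp [Subsingleton.elim (f ω) (f ω')])
  rw [mutualInfo_eq hP.1, e1, e2, entropy_const hP]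
  simp

theorem mutualInfo_le_card [Fintype α] [Fintype β] (hP : ∀ ω, 0 ≤ P ω) (f : Ω → α)
    (g : Ω → β) : mutualInfo P f g ≤ Fintype.card β / Real.log 2 := by
  rw [mutualInfo_eq hP]
  have := entropy_le_prod hP f g
  have := entropy_le_card hP g
  have := Real.log_pos one_lt_two
  gcongr
  linarith

theorem kernel_mem_stdSimplex [Fintype α] [Fintype β] {q : α → ℝ} (hq : q ∈ stdSimplex ℝ α)
    {k : α → β → ℝ} (hk : ∀ a, k a ∈ stdSimplex ℝ β) :
    (fun ω : α × β => q ω.1 * k ω.1 ω.2) ∈ stdSimplex ℝ (α × β) := by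
  refine ⟨fun ω => mul_nonneg (hq.1 _) ((hk _).1 _), ?_⟩
  simp [Fintype.sum_prod_type, ← mul_sum, (hk _).2, hq.2]

theorem law_fst_kernel [Fintype α] [Fintype β] (q : α → ℝ)
    {k : α → β → ℝ} (hk : ∀ a, k a ∈ stdSimplex ℝ β) (a : α) :
    law (fun ω : α × β => q ω.1 * k ω.1 ω.2) (fun ω => ω.1) a = q a := by
  classical
  simp [law, Fintype.sum_prod_type, ← mul_sum, (hk _).2]

theorem law_pair_kernel [Fintype α] [Fintype β] (q : α → ℝ) (k : α → β → ℝ) (a : α) (b : β) :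
    law (fun ω : α × β => q ω.1 * k ω.1 ω.2) (fun ω => (ω.1, ω.2)) (a, b) = q a * k a b := by
  classical
  simp [law, Fintype.sum_prod_type, Prod.ext_iff, ite_and]

variable {U V Z : Type*} [Fintype U] [Fintype V] [Fintype Z] {K : U → V × Z → ℝ}

theorem mutualInfo_le_capacity (hK : IsWiretapChannel K) {q : U → ℝ} (hq : q ∈ stdSimplex ℝ U) :
    mutualInfo (fun ω : U × V × Z => q ω.1 * K ω.1 ω.2) (fun ω => ω.1) (fun ω => ω.2.1)
      ≤ capacity K := by
  refine le_csSup ⟨Fintype.card V / Real.log 2, ?_⟩ ⟨q, hq, rfl⟩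
  rintro r ⟨q, hq, rfl⟩
  exact mutualInfo_le_card (kernel_mem_stdSimplex hq hK).1 _ _

theorem capacity_nonneg (hK : IsWiretapChannel K) : 0 ≤ capacity K := by
  refine Real.sSup_nonneg ?_
  rintro r ⟨q, hq, rfl⟩
  exact mutualInfo_nonneg (kernel_mem_stdSimplex hq hK) _ _

theorem law_mem_stdSimplex [Fintype β] (hP : P ∈ stdSimplex ℝ Ω) (f : Ω → β) :
    law P f ∈ stdSimplex ℝ β :=
  ⟨law_nonneg hP.1 f, (sum_law P f).trans hP.2⟩

/-- Data processing and the definition of capacity, for an input `u X`. -/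
theorem entropy_sub_le_capacity [Fintype α] (hK : IsWiretapChannel K) (hP : P ∈ stdSimplex ℝ Ω)
    (X : Ω → α) (u : α → U) (Y : Ω → V × Z)
    (h : ∀ a y, law P (fun ω => (X ω, Y ω)) (a, y) = law P X a * K (u a) y) :
    entropy P (fun ω => (Y ω).1) - (entropy P (fun ω => (X ω, (Y ω).1)) - entropy P X)
      ≤ capacity K * Real.log 2 := by
  -- Given X, the output depends only on the input u X, so the conditional entropies of V given X
  -- and given u X are the same expectation of -log of the kernel.
  have h' := law_coarsen_kernel X Y u K h
  have e1 := entropy_sub_of_kernel hP.1 X (fun ω => (Y ω).1) (fun a => law (K (u a)) Prod.fst)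
    (law_map_kernel X Y (fun a => K (u a)) h Prod.fst)
  have e2 := entropy_sub_of_kernel hP.1 (fun ω => u (X ω)) (fun ω => (Y ω).1)
    (fun a => law (K a) Prod.fst) (law_map_kernel (fun ω => u (X ω)) Y K h' Prod.fst)
  have hq := law_mem_stdSimplex hP (fun ω => u (X ω))
  have hc := mutualInfo_le_capacity hK hq
  set q := law P (fun ω => u (X ω)) with hqdef
  have hall : ∀ b, law (fun ω : U × V × Z => q ω.1 * K ω.1 ω.2) (fun ω => (ω.1, ω.2)) b =
      law P (fun ω => (u (X ω), Y ω)) b := by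
    rintro ⟨a, y⟩
    rw [h', law_pair_kernel]
  rw [mutualInfo_eq (kernel_mem_stdSimplex hq hK).1, div_le_iff₀ (Real.log_pos one_lt_two)] at hc
  have t1 := entropy_comp_eq_of_law_eq hall (fun ω => ω.1)
  have t2 := entropy_comp_eq_of_law_eq hall (fun ω => ω.2.1)
  have t3 := entropy_comp_eq_of_law_eq hall (fun ω => (ω.1, ω.2.1))
  rw [t1, t2, t3] at hc
  linarith

/-- I(X; V | T) ≤ I(X, T; V), because conditioning lowers the entropy of V; then (X, T) serves as
the variable behind the channel input. -/
theorem condInfo_le_capacity [Fintype α] [Fintype τ] (hK : IsWiretapChannel K)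
    (hP : P ∈ stdSimplex ℝ Ω) (X : Ω → α) (T : Ω → τ) (u : α → U) (Y : Ω → V × Z)
    (h : ∀ a y, law P (fun ω => ((X ω, T ω), Y ω)) (a, y)
      = law P (fun ω => (X ω, T ω)) a * K (u a.1) y) :
    (entropy P (fun ω => ((Y ω).1, T ω)) - entropy P T)
      - (entropy P (fun ω => ((X ω, T ω), (Y ω).1)) - entropy P (fun ω => (X ω, T ω)))
      ≤ capacity K * Real.log 2 := by
  have h1 := entropy_sub_le_capacity hK hP (fun ω => (X ω, T ω)) (fun a => u a.1) Y h
  have h2 := entropy_prod_le hP (fun ω => (Y ω).1) T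
  linarith

theorem auxLaw_mem_stdSimplex [Fintype α] (hK : IsWiretapChannel K) {q : α × U → ℝ}
    (hq : q ∈ stdSimplex ℝ (α × U)) : auxLaw K q ∈ stdSimplex ℝ (α × U × V × Z) := by
  refine ⟨fun ω => mul_nonneg (hq.1 _) ((hK _).1 _), ?_⟩
  have := hq.2
  simp only [Fintype.sum_prod_type] at this
  have h2 : ∀ u, ∑ v, ∑ z, K u (v, z) = 1 := fun u => by
    have := (hK u).2
    rwa [Fintype.sum_prod_type] at this
  simp [auxLaw, Fintype.sum_prod_type, ← mul_sum, h2, this]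

theorem law_auxLaw [Fintype α] (K : U → V × Z → ℝ) (q : α × U → ℝ) (a : α) (y : V × Z) :
    law (auxLaw K q) (fun ω => (ω.1, ω.2.2)) (a, y) = ∑ u, q (a, u) * K u y := by
  classical
  simp only [law, auxLaw, Fintype.sum_prod_type (α₁ := α), Fintype.sum_prod_type (α₁ := U),
    Prod.mk.injEq]
  rw [sum_eq_single a]
  · simp
  · intro b _ hb
    simp [hb]
  · simp

/-- Drop the non-negative I(W; Z) and use I(W; V) ≤ I(W, U; V) ≤ C. -/
theorem secrecy_mem_le_capacity (hK : IsWiretapChannel K) {a : ℕ} {q : Fin a × U → ℝ}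
    (hq : q ∈ stdSimplex ℝ (Fin a × U)) :
    mutualInfo (auxLaw K q) (fun ω => ω.1) (fun ω => ω.2.2.1)
      - mutualInfo (auxLaw K q) (fun ω => ω.1) (fun ω => ω.2.2.2) ≤ capacity K := by
  have hP := auxLaw_mem_stdSimplex hK hq
  have h0 := mutualInfo_nonneg hP (fun ω => ω.1) (fun ω => ω.2.2.2)
  have hk : ∀ (b : Fin a × U) y, law (auxLaw K q) (fun ω => ((ω.1, ω.2.1), ω.2.2)) (b, y)
      = law (auxLaw K q) (fun ω => (ω.1, ω.2.1)) b * K b.2 y := by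
    intro b y
    have e1 := law_equiv (P := fun ω : (Fin a × U) × V × Z => q ω.1 * K ω.1.2 ω.2)
      (Equiv.prodAssoc (Fin a) U (V × Z)).symm (fun ω => (ω.1, ω.2)) (b, y)
    have e2 := law_equiv (P := fun ω : (Fin a × U) × V × Z => q ω.1 * K ω.1.2 ω.2)
      (Equiv.prodAssoc (Fin a) U (V × Z)).symm (fun ω => ω.1) b
    refine e1.trans (Eq.trans ?_ (congrArg (· * K b.2 y) e2.symm))
    rw [law_pair_kernel q (fun b => K b.2),
      law_fst_kernel q (k := fun b => K b.2) (fun b => hK _)]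
  have h1 := entropy_sub_le_capacity hK hP (fun ω => (ω.1, ω.2.1)) (fun b => b.2)
    (fun ω => ω.2.2) hk
  have h2 := entropy_submodular hP.1 (fun ω => ω.2.1) (fun ω => ω.2.2.1) (fun ω => ω.1)
  have e1 := entropy_congr (P := auxLaw K q) (f := fun ω => (ω.2.1, ω.2.2.1, ω.1))
    (g := fun ω => ((ω.1, ω.2.1), ω.2.2.1)) (by intros; simp; tauto)
  have e2 := entropy_congr (P := auxLaw K q) (f := fun ω => (ω.2.1, ω.1))
    (g := fun ω => (ω.1, ω.2.1)) (by intros; simp; tauto)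
  have e3 := entropy_congr (P := auxLaw K q) (f := fun ω => (ω.2.2.1, ω.1))
    (g := fun ω => (ω.1, ω.2.2.1)) (by intros; simp; tauto)
  have : mutualInfo (auxLaw K q) (fun ω => ω.1) (fun ω => ω.2.2.1) ≤ capacity K := by
    rw [mutualInfo_eq hP.1, div_le_iff₀ (Real.log_pos one_lt_two)]
    linarith
  linarith

theorem secrecyCapacity_le_capacity (hK : IsWiretapChannel K) :
    secrecyCapacity K ≤ capacity K := by
  refine Real.sSup_le ?_ (capacity_nonneg hK)
  rintro r ⟨a, q, hq, rfl⟩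
  exact secrecy_mem_le_capacity hK hq

theorem le_secrecyCapacity (hK : IsWiretapChannel K) {a : ℕ} {q : Fin a × U → ℝ}
    (hq : q ∈ stdSimplex ℝ (Fin a × U)) :
    mutualInfo (auxLaw K q) (fun ω => ω.1) (fun ω => ω.2.2.1)
      - mutualInfo (auxLaw K q) (fun ω => ω.1) (fun ω => ω.2.2.2) ≤ secrecyCapacity K := by
  refine le_csSup ⟨capacity K, ?_⟩ ⟨a, q, hq, rfl⟩
  rintro r ⟨a, q, hq, rfl⟩
  exact secrecy_mem_le_capacity hK hq

/-- A constant W gives the value 0. Without any input letter the set is empty, and its supremum is 0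
by convention. -/
theorem secrecyCapacity_nonneg (hK : IsWiretapChannel K) : 0 ≤ secrecyCapacity K := by
  classical
  rcases isEmpty_or_nonempty U with hU | ⟨⟨u⟩⟩
  · refine Real.sSup_nonneg ?_
    rintro r ⟨a, q, hq, rfl⟩
    have := hq.2
    simp at this
  · have hq : Pi.single (0, u) 1 ∈ stdSimplex ℝ (Fin 1 × U) := single_mem_stdSimplex ℝ _
    have hP := auxLaw_mem_stdSimplex hK hq
    have := le_secrecyCapacity hK hq
    rw [mutualInfo_of_subsingleton hP, mutualInfo_of_subsingleton hP] at this
    linarith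

theorem law_comp_eq_mul [Fintype β] {Ω' : Type*} [Fintype Ω'] {P' : Ω' → ℝ} (F : Ω → β)
    (t : Ω → τ) (F' : Ω' → β) (r : ℝ) (c : τ)
    (h : ∀ b, law P (fun ω => (F ω, t ω)) (b, c) = r * law P' F' b) (φ : β → γ) (d : γ) :
    law P (fun ω => (φ (F ω), t ω)) (d, c) = r * law P' (fun ω => φ (F' ω)) d := by
  classical
  have h1 : law P (fun ω => (φ (F ω), t ω)) (d, c)
      = ∑ b, if φ b = d then law P (fun ω => (F ω, t ω)) (b, c) else 0 := by
    simp only [law, ← sum_ite_const_zero, Prod.mk.injEq]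
    rw [sum_comm]
    refine sum_congr rfl fun ω _ => ?_
    rw [sum_eq_single (F ω)]
    · by_cases h1 : t ω = c <;> by_cases h2 : φ (F ω) = d <;> simp [h1, h2]
    · intro b _ hb
      simp [hb.symm]
    · simp
  rw [h1, law_comp P' F' φ]
  simp only [h]
  simp only [law.eq_1 (law P' F'), mul_sum, mul_ite, mul_zero]

theorem sum_mul_entropy_comp_eq [Fintype β] [Fintype γ] [Fintype τ] {Ω' : Type*} [Fintype Ω']
    (hP : ∀ ω, 0 ≤ P ω) (F : Ω → β) (t : Ω → τ) (P' : τ → Ω' → ℝ) (F' : Ω' → β)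
    (h : ∀ c b, law P (fun ω => (F ω, t ω)) (b, c) = law P t c * law (P' c) F' b) (φ : β → γ) :
    ∑ c, law P t c * entropy (P' c) (fun ω => φ (F' ω))
      = entropy P (fun ω => (φ (F ω), t ω)) - entropy P t :=
  sum_mul_entropy_eq hP (fun ω => φ (F ω)) t P' (fun ω => φ (F' ω)) fun b c =>
    law_comp_eq_mul _ _ _ _ _ (h c) φ b

/-- The definition of the secrecy capacity, conditioned on a side information `T`. -/
theorem condInfo_sub_le_secrecyCapacity_of_fin {a : ℕ} [Fintype τ] (hK : IsWiretapChannel K)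
    (hP : P ∈ stdSimplex ℝ Ω) (X : Ω → Fin a) (T : Ω → τ) (u : Fin a → U) (Y : Ω → V × Z)
    (h : ∀ b y, law P (fun ω => ((X ω, T ω), Y ω)) (b, y)
      = law P (fun ω => (X ω, T ω)) b * K (u b.1) y) :
    (entropy P (fun ω => ((Y ω).1, T ω)) - entropy P (fun ω => ((X ω, (Y ω).1), T ω)))
      - (entropy P (fun ω => ((Y ω).2, T ω)) - entropy P (fun ω => ((X ω, (Y ω).2), T ω)))
      ≤ secrecyCapacity K * Real.log 2 := by
  classical
  -- The conditional law of (X, u X) given T = t: X itself plays the role of the auxiliary variable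
  -- W. If T = t has probability 0, this is the zero function and not a law, but such t carry no
  -- weight below.
  let q : τ → Fin a × U → ℝ := fun t b =>
    if b.2 = u b.1 then law P (fun ω => (X ω, T ω)) (b.1, t) / law P T t else 0
  have hq : ∀ t, law P T t ≠ 0 → q t ∈ stdSimplex ℝ (Fin a × U) := by
    intro t ht
    refine ⟨fun b => ?_, ?_⟩
    · dsimp only [q]
      split_ifs
      · exact div_nonneg (law_nonneg hP.1 _ _) (law_nonneg hP.1 _ _)
      · exact le_rfl
    · simp only [q, Fintype.sum_prod_type, sum_ite_eq', mem_univ, if_true]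
      rw [← sum_div, sum_law_left, div_self ht]
  have hz : ∀ t, law P T t = 0 → ∀ b, law P (fun ω => (X ω, T ω)) (b, t) = 0 := by
    intro t ht b
    rw [← sum_law_left P X T t] at ht
    exact (sum_eq_zero_iff_of_nonneg fun b _ => law_nonneg hP.1 _ _).1 ht b (mem_univ b)
  have hl : ∀ t b, law P (fun ω => ((X ω, Y ω), T ω)) (b, t)
      = law P T t * law (auxLaw K (q t)) (fun ω => (ω.1, ω.2.2)) b := by
    rintro t ⟨x, y⟩
    have e : law P (fun ω => ((X ω, Y ω), T ω)) ((x, y), t)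
        = law P (fun ω => ((X ω, T ω), Y ω)) ((x, t), y) := by
      refine law_eq_of_iff fun ω => ?_
      simp only [Prod.mk.injEq]; tauto
    rw [e, h, law_auxLaw]
    simp only [q, ite_mul, zero_mul, sum_ite_eq', mem_univ, if_true]
    by_cases ht : law P T t = 0
    · simp [hz t ht, ht]
    · field_simp
  have c1 := sum_mul_entropy_comp_eq hP.1 _ T _ _ hl (fun b => b.2.1)
  have c2 := sum_mul_entropy_comp_eq hP.1 _ T _ _ hl (fun b => (b.1, b.2.1))
  have c3 := sum_mul_entropy_comp_eq hP.1 _ T _ _ hl (fun b => b.2.2)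
  have c4 := sum_mul_entropy_comp_eq hP.1 _ T _ _ hl (fun b => (b.1, b.2.2))
  have hsum : ∑ t, law P T t * (entropy (auxLaw K (q t)) (fun ω => ω.2.2.1)
      - entropy (auxLaw K (q t)) (fun ω => (ω.1, ω.2.2.1))
      - (entropy (auxLaw K (q t)) (fun ω => ω.2.2.2)
      - entropy (auxLaw K (q t)) (fun ω => (ω.1, ω.2.2.2))))
      ≤ ∑ t, law P T t * (secrecyCapacity K * Real.log 2) := by
    refine sum_le_sum fun t _ => ?_
    by_cases ht : law P T t = 0
    · simp [ht]
    refine mul_le_mul_of_nonneg_left ?_ (law_nonneg hP.1 _ _)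
    have h1 := le_secrecyCapacity hK (hq t ht)
    have hP' := auxLaw_mem_stdSimplex hK (hq t ht)
    -- The entropy of W occurs in both informations and cancels in their difference.
    rw [mutualInfo_eq hP'.1, mutualInfo_eq hP'.1, ← sub_div,
      div_le_iff₀ (Real.log_pos one_lt_two)] at h1
    linarith
  rw [← sum_mul, sum_law, hP.2, one_mul] at hsum
  simp only [mul_sub, sum_sub_distrib] at hsum
  dsimp only at c1 c2 c3 c4
  linarith

theorem condInfo_sub_le_secrecyCapacity [Fintype α] [Fintype τ] (hK : IsWiretapChannel K)
    (hP : P ∈ stdSimplex ℝ Ω) (X : Ω → α) (T : Ω → τ) (u : α → U) (Y : Ω → V × Z)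
    (h : ∀ b y, law P (fun ω => ((X ω, T ω), Y ω)) (b, y)
      = law P (fun ω => (X ω, T ω)) b * K (u b.1) y) :
    (entropy P (fun ω => ((Y ω).1, T ω)) - entropy P (fun ω => ((X ω, (Y ω).1), T ω)))
      - (entropy P (fun ω => ((Y ω).2, T ω)) - entropy P (fun ω => ((X ω, (Y ω).2), T ω)))
      ≤ secrecyCapacity K * Real.log 2 := by
  classical
  -- The auxiliary alphabets in `secrecyCapacity` are the types `Fin a`, so the values of X are
  -- renumbered.
  let e := Fintype.equivFin α
  have := condInfo_sub_le_secrecyCapacity_of_fin hK hP (fun ω => e (X ω)) T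
    (fun b => u (e.symm b)) Y (by
      rintro ⟨x, t⟩ y
      have h' := h (e.symm x, t) y
      simp only [law, Prod.mk.injEq] at h' ⊢
      simpa [Equiv.eq_symm_apply] using h')
  rwa [entropy_congr (f := fun ω => ((e (X ω), (Y ω).1), T ω))
    (g := fun ω => ((X ω, (Y ω).1), T ω)) (by simp),
    entropy_congr (f := fun ω => ((e (X ω), (Y ω).2), T ω))
    (g := fun ω => ((X ω, (Y ω).2), T ω)) (by simp)] at this

end SingleLetter
-- The memoryless channel, and the effect of changing one observation.
section Multiletter

variable {Ω α β γ : Type*} [Fintype Ω]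

/-- A coordinate of a finite probability space with a prescribed conditional law. -/
theorem law_kernel_of_equiv [Fintype α] {Ω' : Type*} [Fintype Ω'] (P : Ω → ℝ) (e : α × Ω' ≃ Ω)
    (F : Ω → γ) (Y : Ω → α) (P' : Ω' → ℝ) (k : γ → α → ℝ)
    (hP : ∀ b ω, P (e (b, ω)) = P' ω * k (F (e (b, ω))) b) (hY : ∀ b ω, Y (e (b, ω)) = b)
    (hF : ∀ b b' ω, F (e (b, ω)) = F (e (b', ω))) (hk : ∀ a, ∑ b, k a b = 1) (a : γ) (b : α) :
    law P (fun ω => (F ω, Y ω)) (a, b) = law P F a * k a b := by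
  classical
  rw [← law_equiv e, ← law_equiv e F]
  have h1 : law (fun ω => P (e ω)) (fun ω => (F (e ω), Y (e ω))) (a, b)
      = (∑ ω, if F (e (b, ω)) = a then P' ω else 0) * k a b := by
    simp only [law, Fintype.sum_prod_type, hY, hP, Prod.mk.injEq]
    rw [sum_eq_single b]
    · simp only [and_true, sum_mul, ite_mul, zero_mul]
      refine sum_congr rfl fun ω _ => ?_
      split_ifs with h
      · rw [h]
      · rfl
    · intro b' _ hb
      simp [hb]
    · simp
  have h2 : law (fun ω => P (e ω)) (fun ω => F (e ω)) a
      = ∑ ω, if F (e (b, ω)) = a then P' ω else 0 := by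
    simp only [law, Fintype.sum_prod_type, hP]
    rw [sum_comm]
    refine sum_congr rfl fun ω _ => ?_
    simp only [fun b' => hF b' b ω]
    split_ifs with h
    · rw [h, ← mul_sum, hk, mul_one]
    · simp
  rw [h1, h2]

variable {ι κ X U V Z : Type*} [Fintype ι] [Fintype κ] [Fintype X] [Fintype V]
  [Fintype Z]

theorem prod_mem_stdSimplex [DecidableEq ι] {q : ι → X → ℝ} (hq : ∀ i, q i ∈ stdSimplex ℝ X) :
    (fun x : ι → X => ∏ i, q i (x i)) ∈ stdSimplex ℝ (ι → X) := by
  refine ⟨fun x => prod_nonneg fun i _ => (hq i).1 _, ?_⟩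
  have := (prod_univ_sum (fun _ : ι => (univ : Finset X)) q).symm
  rw [Fintype.piFinset_univ] at this
  rw [this]
  exact prod_eq_one fun i _ => (hq i).2

/-- The joint law of an i.i.d. source and of the outputs of a memoryless channel. -/
def seqLaw (p : X → ℝ) (K : U → V × Z → ℝ) (enc : κ → (ι → X) → U)
    (ω : (ι → X) × (κ → V × Z)) : ℝ :=
  (∏ i, p (ω.1 i)) * ∏ c, K (enc c ω.1) (ω.2 c)

variable {p : X → ℝ} {K : U → V × Z → ℝ} {enc : κ → (ι → X) → U}

theorem seqLaw_mem_stdSimplex [DecidableEq ι] [DecidableEq κ] (hp : p ∈ stdSimplex ℝ X)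
    (hK : IsWiretapChannel K) :
    seqLaw p K enc ∈ stdSimplex ℝ ((ι → X) × (κ → V × Z)) :=
  kernel_mem_stdSimplex (q := fun x : ι → X => ∏ i, p (x i))
    (k := fun x (y : κ → V × Z) => ∏ c, K (enc c x) (y c))
    (prod_mem_stdSimplex fun _ => hp) fun x => prod_mem_stdSimplex fun c => hK (enc c x)

/-- The channel is memoryless. -/
theorem law_output_kernel [DecidableEq ι] [DecidableEq κ] (hK : IsWiretapChannel K) (c : κ)
    (F : (ι → X) × (κ → V × Z) → γ) (u : γ → U) (hu : ∀ ω, u (F ω) = enc c ω.1)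
    (hF : ∀ x y y', (∀ j, j ≠ c → y j = y' j) → F (x, y) = F (x, y')) (a : γ) (b : V × Z) :
    law (seqLaw p K enc) (fun ω => (F ω, ω.2 c)) (a, b)
      = law (seqLaw p K enc) F a * K (u a) b := by
  classical
  -- Split off the output at c: F ignores it, and it enters the product law only through its own
  -- factor.
  let e : (V × Z) × ((ι → X) × ({j // j ≠ c} → V × Z)) ≃ (ι → X) × (κ → V × Z) :=
    { toFun := fun w => (w.2.1, (Equiv.funSplitAt c (V × Z)).symm (w.1, w.2.2))
      invFun := fun w => (w.2 c, (w.1, fun j => w.2 j))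
      left_inv := by
        rintro ⟨b, x, y⟩
        ext j <;> simp [Equiv.funSplitAt, Equiv.piSplitAt]
        all_goals simp [j.2]
      right_inv := by
        rintro ⟨x, y⟩
        ext j <;> simp [Equiv.funSplitAt, Equiv.piSplitAt]
        all_goals split_ifs with h <;> simp [h] }
  refine law_kernel_of_equiv (seqLaw p K enc) e F (fun ω => ω.2 c)
    (fun w => (∏ i, p (w.1 i)) * ∏ j : {j // j ≠ c}, K (enc j w.1) (w.2 j)) (fun a => K (u a))
    ?_ ?_ ?_ (fun a => (hK _).2) a b
  · rintro b ⟨x, y⟩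
    simp only [hu]
    simp only [seqLaw, e, Equiv.coe_fn_mk]
    rw [Fintype.prod_eq_mul_prod_subtype_ne _ c]
    have : ∀ j : {j // j ≠ c}, (Equiv.funSplitAt c (V × Z)).symm (b, y) j = y j := by
      intro j
      simp [Equiv.funSplitAt, Equiv.piSplitAt, j.2]
    simp only [this]
    simp only [Equiv.funSplitAt, Equiv.piSplitAt, Equiv.coe_fn_symm_mk, dite_true]
    ring
  · rintro b ⟨x, y⟩
    simp [e, Equiv.funSplitAt, Equiv.piSplitAt]
  · rintro b b' ⟨x, y⟩
    refine hF _ _ _ fun j hj => ?_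
    simp [Equiv.funSplitAt, Equiv.piSplitAt, hj]

theorem law_coord_kernel [DecidableEq ι] (hp : p ∈ stdSimplex ℝ X) (i : ι) (F : (ι → X) → γ)
    (hF : ∀ x x' : ι → X, (∀ j, j ≠ i → x j = x' j) → F x = F x') (a : γ) (b : X) :
    law (fun x : ι → X => ∏ i, p (x i)) (fun x => (F x, x i)) (a, b)
      = law (fun x : ι → X => ∏ i, p (x i)) F a * p b := by
  let e : X × ({j // j ≠ i} → X) ≃ (ι → X) := (Equiv.funSplitAt i X).symm
  refine law_kernel_of_equiv _ e F (fun x => x i) (fun x => ∏ j, p (x j)) (fun _ => p)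
    ?_ ?_ ?_ (fun _ => hp.2) a b
  · intro b x
    simp only [e]
    rw [Fintype.prod_eq_mul_prod_subtype_ne _ i]
    have : ∀ j : {j // j ≠ i}, (Equiv.funSplitAt i X).symm (b, x) j = x j := by
      intro j
      simp [Equiv.funSplitAt, Equiv.piSplitAt, j.2]
    simp only [this]
    simp only [Equiv.funSplitAt, Equiv.piSplitAt, Equiv.coe_fn_symm_mk, dite_true]
    ring
  · intro b x
    simp [e, Equiv.funSplitAt, Equiv.piSplitAt]
  · intro b b' x
    refine hF _ _ fun j hj => ?_
    simp [e, Equiv.funSplitAt, Equiv.piSplitAt, hj]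

theorem law_seqLaw_source [DecidableEq ι] [DecidableEq κ]
    (hK : IsWiretapChannel K) :
    law (seqLaw p K enc) (fun ω => ω.1) = fun x => ∏ i, p (x i) :=
  funext fun x => law_fst_kernel (k := fun x (y : κ → V × Z) => ∏ c, K (enc c x) (y c))
    (fun x : ι → X => ∏ i, p (x i)) (fun x => prod_mem_stdSimplex fun c => hK (enc c x)) x

/-- The letters of the source are independent. -/
theorem entropy_source_insert [DecidableEq ι] [DecidableEq κ] (hp : p ∈ stdSimplex ℝ X)
    (hK : IsWiretapChannel K) (Q : Finset ι) (i : ι) (hi : i ∉ Q) :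
    entropy (seqLaw p K enc) (fun ω => ((fun j : Q => ω.1 j), ω.1 i))
      = entropy (seqLaw p K enc) (fun ω (j : Q) => ω.1 j)
        + entropy (seqLaw p K enc) (fun ω => ω.1 i) := by
  let π : (ι → X) → ℝ := fun x => ∏ i, p (x i)
  have hπ : π ∈ stdSimplex ℝ (ι → X) := prod_mem_stdSimplex fun _ => hp
  have h1 : ∀ x, law (seqLaw p K enc) (fun ω => ω.1) x = law π id x := by
    intro x
    rw [law_seqLaw_source hK, law, sum_eq_single x]
    · simp [π]
    · intro x' _ hx
      simp [hx]
    · simp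
  have e1 := entropy_comp_eq_of_law_eq h1 (fun x => ((fun j : Q => x j), x i))
  have e2 := entropy_comp_eq_of_law_eq h1 (fun x (j : Q) => x j)
  have e3 := entropy_comp_eq_of_law_eq h1 (fun x => x i)
  have k1 := entropy_sub_of_kernel hπ.1 (fun x (j : Q) => x j) (fun x => x i) (fun _ => p)
    (law_coord_kernel hp i _ fun x x' h => funext fun j => h j fun hj => hi (hj ▸ j.2))
  -- The same kernel with a trivial conditioning variable computes the entropy of the letter, so
  -- conditioning on the letters in Q does not change it.
  have k2 := entropy_sub_of_kernel hπ.1 (fun _ => fun _ : Q => ()) (fun x => x i) (fun _ => p)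
    (law_coord_kernel hp i _ fun x x' h => rfl)
  have k3 := entropy_const hπ (fun _ : Q => ())
  have k4 := entropy_congr (P := π) (f := fun x => ((fun _ : Q => ()), x i)) (g := fun x => x i)
    (by simp)
  simp only [id] at e1 e2 e3
  linarith

variable [DecidableEq ι] [DecidableEq κ]

/-- The conditional information `I(X; O | A)` between the source and the observation `o c (y c)` of
every output `y c`, given the letters in `A`. -/
noncomputable def obsInfo (p : X → ℝ) (K : U → V × Z → ℝ) (enc : κ → (ι → X) → U) (A : Finset ι)
    (o : κ → V × Z → γ) : ℝ :=
  entropy (seqLaw p K enc) (fun ω => ((fun c => o c (ω.2 c)), fun j : A => ω.1 j))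
    - entropy (seqLaw p K enc) (fun ω (j : A) => ω.1 j)
    - (entropy (seqLaw p K enc) (fun ω => ((fun c => o c (ω.2 c)), ω.1))
      - entropy (seqLaw p K enc) (fun ω => ω.1))

/-- The observations at all channel uses but `c`, and the letters in `A`. -/
def obsRest (A : Finset ι) (o : κ → V × Z → γ) (c : κ) (ω : (ι → X) × (κ → V × Z)) :
    ({j // j ≠ c} → γ) × (A → X) :=
  (fun j => o j (ω.2 j), fun j => ω.1 j)

omit [Fintype κ] [Fintype V] [Fintype Z] in
theorem forall_obs_iff (o : κ → V × Z → γ) (c : κ) (g : V × Z → γ) (y y' : κ → V × Z) :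
    ((fun j => Function.update o c g j (y j)) = fun j => Function.update o c g j (y' j)) ↔
      g (y c) = g (y' c) ∧
      (fun j : {j // j ≠ c} => o j (y j)) = (fun j : {j // j ≠ c} => o j (y' j)) := by
  constructor
  · intro h
    refine ⟨by simpa using congrFun h c, funext fun j => ?_⟩
    simpa [Function.update_of_ne j.2] using congrFun h j
  · rintro ⟨h1, h2⟩
    funext j
    by_cases hj : j = c
    · subst hj; simpa using h1
    · simpa [Function.update_of_ne hj] using congrFun h2 ⟨j, hj⟩

/-- Isolates the observation at c, so that everything else can be cancelled or treated as side
information when two choices of g are compared. -/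
theorem obsInfo_update (A : Finset ι) (o : κ → V × Z → γ) (c : κ) (g : V × Z → γ) :
    obsInfo p K enc A (Function.update o c g) =
      entropy (seqLaw p K enc) (fun ω => (g (ω.2 c), obsRest A o c ω))
      - entropy (seqLaw p K enc) (fun ω (j : A) => ω.1 j)
      - (entropy (seqLaw p K enc) (fun ω => ((ω.1, g (ω.2 c)), obsRest A o c ω))
        - entropy (seqLaw p K enc) (fun ω => ω.1)) := by
  unfold obsInfo
  have e1 := entropy_congr (P := seqLaw p K enc)
    (f := fun ω => ((fun j => Function.update o c g j (ω.2 j)), fun j : A => ω.1 j))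
    (g := fun ω => (g (ω.2 c), obsRest A o c ω)) (by
      intro ω ω'
      simp only [obsRest, Prod.mk.injEq, forall_obs_iff, and_assoc])
  have e2 := entropy_congr (P := seqLaw p K enc)
    (f := fun ω => ((fun j => Function.update o c g j (ω.2 j)), ω.1))
    (g := fun ω => ((ω.1, g (ω.2 c)), obsRest A o c ω)) (by
      intro ω ω'
      simp only [obsRest, Prod.mk.injEq, forall_obs_iff]
      constructor
      · rintro ⟨⟨h1, h2⟩, h3⟩
        exact ⟨⟨h3, h1⟩, h2, by simp [h3]⟩
      · rintro ⟨⟨h3, h1⟩, h2, -⟩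
        exact ⟨⟨h1, h2⟩, h3⟩)
  rw [e1, e2]

omit [Fintype ι] [Fintype κ] [Fintype X] [Fintype V] [Fintype Z] [DecidableEq ι] [DecidableEq κ] in
theorem obsRest_congr (A : Finset ι) (o : κ → V × Z → γ) (c : κ) (x : ι → X) (y y' : κ → V × Z)
    (h : ∀ j, j ≠ c → y j = y' j) : obsRest A o c (x, y) = obsRest A o c (x, y') := by
  simp only [obsRest, Prod.mk.injEq, and_true]
  exact funext fun j => by rw [h j j.2]

section Steps

variable [Fintype γ] (hp : p ∈ stdSimplex ℝ X) (hK : IsWiretapChannel K) (A : Finset ι)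
  (o : κ → V × Z → γ) (c : κ)

include hp hK

/-- The difference is I(X; V_c | T), where X is the whole source and T = `obsRest` holds the letters
in A and the other observations. -/
theorem obsInfo_step_capacity [Fintype U] (e : γ) (v : V → γ) (hv : Function.Injective v) :
    obsInfo p K enc A (Function.update o c fun y => v y.1)
      - obsInfo p K enc A (Function.update o c fun _ => e) ≤ capacity K * Real.log 2 := by
  classical
  rw [obsInfo_update, obsInfo_update]
  have h := condInfo_le_capacity hK (seqLaw_mem_stdSimplex (enc := enc) hp hK) (fun ω => ω.1)
    (obsRest A o c) (enc c) (fun ω => ω.2 c) (fun a y =>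
      law_output_kernel hK c _ (fun a => enc c a.1) (fun _ => rfl)
        (fun x y y' hy => by simp only [obsRest_congr A o c x y y' hy]) a y)
  have e1 := entropy_congr (P := seqLaw p K enc) (f := fun ω => (v (ω.2 c).1, obsRest A o c ω))
    (g := fun ω => ((ω.2 c).1, obsRest A o c ω)) (by simp [hv.eq_iff])
  have e2 := entropy_congr (P := seqLaw p K enc)
    (f := fun ω => ((ω.1, v (ω.2 c).1), obsRest A o c ω))
    (g := fun ω => ((ω.1, obsRest A o c ω), (ω.2 c).1))
    (by intros; simp [hv.eq_iff]; tauto)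
  have e3 := entropy_congr (P := seqLaw p K enc) (f := fun ω => (e, obsRest A o c ω))
    (g := obsRest A o c) (by simp)
  have e4 := entropy_congr (P := seqLaw p K enc) (f := fun ω => ((ω.1, e), obsRest A o c ω))
    (g := fun ω => (ω.1, obsRest A o c ω)) (by simp)
  linarith

/-- The difference is I(X; V_c | T) - I(X; Z_c | T), with the whole source as auxiliary variable and
T = `obsRest`. The injections put both outputs into a common observation alphabet. -/
theorem obsInfo_step_secrecy [Fintype U] (v : V → γ) (hv : Function.Injective v) (z : Z → γ)
    (hz : Function.Injective z) :
    obsInfo p K enc A (Function.update o c fun y => v y.1)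
      - obsInfo p K enc A (Function.update o c fun y => z y.2)
      ≤ secrecyCapacity K * Real.log 2 := by
  classical
  rw [obsInfo_update, obsInfo_update]
  have h := condInfo_sub_le_secrecyCapacity hK (seqLaw_mem_stdSimplex (enc := enc) hp hK)
    (fun ω => ω.1) (obsRest A o c) (enc c) (fun ω => ω.2 c) (fun a y =>
      law_output_kernel hK c _ (fun a => enc c a.1) (fun _ => rfl)
        (fun x y y' hy => by simp only [obsRest_congr A o c x y y' hy]) a y)
  have e1 := entropy_congr (P := seqLaw p K enc) (f := fun ω => (v (ω.2 c).1, obsRest A o c ω))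
    (g := fun ω => ((ω.2 c).1, obsRest A o c ω)) (by simp [hv.eq_iff])
  have e2 := entropy_congr (P := seqLaw p K enc)
    (f := fun ω => ((ω.1, v (ω.2 c).1), obsRest A o c ω))
    (g := fun ω => ((ω.1, (ω.2 c).1), obsRest A o c ω)) (by simp [hv.eq_iff])
  have e3 := entropy_congr (P := seqLaw p K enc) (f := fun ω => (z (ω.2 c).2, obsRest A o c ω))
    (g := fun ω => ((ω.2 c).2, obsRest A o c ω)) (by simp [hz.eq_iff])
  have e4 := entropy_congr (P := seqLaw p K enc)
    (f := fun ω => ((ω.1, z (ω.2 c).2), obsRest A o c ω))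
    (g := fun ω => ((ω.1, (ω.2 c).2), obsRest A o c ω)) (by simp [hz.eq_iff])
  linarith

omit [Fintype γ] in
-- The input at c is determined by the letters in A, which `obsRest` already records; the rest of
-- the source says nothing more about the output at c.
theorem obsInfo_step_zero (u : (A → X) → U) (hu : ∀ x, enc c x = u fun j => x j)
    (g : V × Z → γ) (e : γ) :
    obsInfo p K enc A (Function.update o c g)
      = obsInfo p K enc A (Function.update o c fun _ => e) := by
  classical
  rw [obsInfo_update, obsInfo_update]
  have hP := seqLaw_mem_stdSimplex (enc := enc) hp hK
  have k1 := entropy_sub_of_kernel hP.1 (obsRest A o c) (fun ω => g (ω.2 c))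
    (fun a => law (K (u a.2)) g) (law_map_kernel (obsRest A o c) (fun ω => ω.2 c)
      (fun a => K (u a.2))
      (law_output_kernel hK c (obsRest A o c) (fun a => u a.2) (fun ω => (hu ω.1).symm)
        (fun x y y' hy => obsRest_congr A o c x y y' hy)) g)
  have k2 := entropy_sub_of_kernel hP.1 (fun ω => (ω.1, obsRest A o c ω)) (fun ω => g (ω.2 c))
    (fun a => law (K (u a.2.2)) g) (law_map_kernel (fun ω => (ω.1, obsRest A o c ω))
      (fun ω => ω.2 c) (fun a => K (u a.2.2))
      (law_output_kernel hK c (fun ω => (ω.1, obsRest A o c ω)) (fun a => u a.2.2)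
        (fun ω => (hu ω.1).symm)
        (fun x y y' hy => by simp only [obsRest_congr A o c x y y' hy])) g)
  have e1 := entropy_congr (P := seqLaw p K enc) (f := fun ω => (g (ω.2 c), obsRest A o c ω))
    (g := fun ω => (obsRest A o c ω, g (ω.2 c))) (by intros; simp; tauto)
  have e2 := entropy_congr (P := seqLaw p K enc)
    (f := fun ω => ((ω.1, g (ω.2 c)), obsRest A o c ω))
    (g := fun ω => ((ω.1, obsRest A o c ω), g (ω.2 c))) (by intros; simp; tauto)
  have e3 := entropy_congr (P := seqLaw p K enc) (f := fun ω => (e, obsRest A o c ω))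
    (g := obsRest A o c) (by simp)
  have e4 := entropy_congr (P := seqLaw p K enc) (f := fun ω => ((ω.1, e), obsRest A o c ω))
    (g := fun ω => (ω.1, obsRest A o c ω)) (by simp)
  linarith

end Steps

omit [Fintype ι] [Fintype X] [Fintype V] [Fintype Z] [DecidableEq ι] in
-- A hybrid argument: pass from f₀ to f₁ one coordinate at a time and telescope. The hypothesis
-- allows every o, since the other coordinates may be in either state.
theorem sub_le_sum_of_update {β : Type*} (Φ : (κ → β) → ℝ) (f₀ f₁ : κ → β) (w : κ → ℝ)
    (h : ∀ o c, Φ (Function.update o c (f₁ c)) - Φ (Function.update o c (f₀ c)) ≤ w c) :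
    Φ f₁ - Φ f₀ ≤ ∑ c, w c := by
  have : ∀ s : Finset κ, Φ (s.piecewise f₁ f₀) - Φ f₀ ≤ ∑ c ∈ s, w c := by
    intro s
    induction s using Finset.induction_on with
    | empty => simp
    | insert c s hc ih =>
      rw [sum_insert hc, piecewise_insert]
      have h1 := h (s.piecewise f₁ f₀) c
      have h2 : Function.update (s.piecewise f₁ f₀) c (f₀ c) = s.piecewise f₁ f₀ := by
        rw [Function.update_eq_self_iff, piecewise_eq_of_notMem _ _ _ hc]
      rw [h2] at h1
      linarith
  simpa using this univ

end Multiletter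
-- The converse bounds for the letters outside a given set.
section Converse

variable {γ ι κ X Y U V Z : Type*} [Fintype ι] [Fintype κ] [Fintype X] [Fintype U] [Fintype V]
  [Fintype Z] [DecidableEq ι] [DecidableEq κ] {p : X → ℝ} {K : U → V × Z → ℝ}
  {enc : κ → (ι → X) → U}

omit [Fintype U] in
/-- The letters are independent, so that their informations add up to at most the total one. -/
theorem sum_letterInfo_le_obsInfo (hp : p ∈ stdSimplex ℝ X) (hK : IsWiretapChannel K)
    (A : Finset ι) (dec : (κ → V) → ι → Y) (v : V → γ) (hv : Function.Injective v) :
    ∑ i ∈ Aᶜ, (entropy (seqLaw p K enc) (fun ω => ω.1 i)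
        + entropy (seqLaw p K enc) (fun ω => dec (fun c => (ω.2 c).1) i)
        - entropy (seqLaw p K enc) (fun ω => (ω.1 i, dec (fun c => (ω.2 c).1) i)))
      ≤ obsInfo p K enc A (fun _ y => v y.1) := by
  have hP := seqLaw_mem_stdSimplex (enc := enc) hp hK
  set P := seqLaw p K enc with hPdef
  let W : (ι → X) × (κ → V × Z) → κ → V := fun ω c => (ω.2 c).1
  -- The right-hand side is I(X_S; W | X_A). By independence of the letters, a new letter i raises
  -- it by at least I(X_i; W), and this is at least the information between the letter and its
  -- reconstruction, a function of W.
  have main : ∀ S : Finset ι, Disjoint A S →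
      ∑ i ∈ S, (entropy P (fun ω => ω.1 i)
        + entropy P (fun ω => dec (W ω) i) - entropy P (fun ω => (ω.1 i, dec (W ω) i)))
      ≤ (entropy P (fun ω (j : (A ∪ S : Finset ι)) => ω.1 j)
          - entropy P (fun ω => ((fun j : (A ∪ S : Finset ι) => ω.1 j), W ω)))
        - (entropy P (fun ω (j : A) => ω.1 j)
          - entropy P (fun ω => ((fun j : A => ω.1 j), W ω))) := by
    intro S
    induction S using Finset.induction_on with
    | empty =>
      intro _
      rw [sum_empty, union_empty, sub_self]
    | insert i S hi ih =>
      intro hd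
      rw [disjoint_insert_right] at hd
      have ih := ih hd.2
      rw [sum_insert hi, union_insert]
      have hn : i ∉ A ∪ S := by simp [hd.1, hi]
      generalize A ∪ S = Q at *
      have h1 := entropy_source_insert (enc := enc) hp hK Q i hn
      have h2 := entropy_submodular hP.1 (fun ω => ω.1 i) (fun ω (j : Q) => ω.1 j) W
      have h3 := entropy_submodular hP.1 (fun ω => ω.1 i) W (fun ω => dec (W ω) i)
      have e1 := entropy_congr (P := P) (f := fun ω => ((fun j : Q => ω.1 j), ω.1 i))
        (g := fun ω (j : (insert i Q : Finset ι)) => ω.1 j) (by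
          intro ω ω'
          simp only [Prod.mk.injEq, funext_iff, Subtype.forall, forall_mem_insert]
          tauto)
      have e2 := entropy_congr (P := P)
        (f := fun ω => (ω.1 i, (fun j : Q => ω.1 j), W ω))
        (g := fun ω => ((fun j : (insert i Q : Finset ι) => ω.1 j), W ω)) (by
          intro ω ω'
          simp only [Prod.mk.injEq, funext_iff, Subtype.forall, forall_mem_insert]
          tauto)
      have e3 := entropy_congr (P := P) (f := fun ω => (ω.1 i, W ω, dec (W ω) i))
        (g := fun ω => (ω.1 i, W ω)) (by
          intro ω ω'
          simp only [Prod.mk.injEq]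
          refine ⟨fun h => ⟨h.1, h.2.1⟩, fun h => ⟨h.1, h.2, by rw [h.2]⟩⟩)
      have e4 := entropy_congr (P := P) (f := fun ω => (W ω, dec (W ω) i))
        (g := W) (by
          intro ω ω'
          simp only [Prod.mk.injEq]
          refine ⟨fun h => h.1, fun h => ⟨h, by rw [h]⟩⟩)
      linarith
  have h := main Aᶜ disjoint_compl_right
  rw [union_compl] at h
  refine h.trans (le_of_eq ?_)
  unfold obsInfo
  have e1 := entropy_congr (P := P) (f := fun ω (j : (univ : Finset ι)) => ω.1 j)
    (g := fun ω => ω.1) (by intro ω ω'; simp [funext_iff])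
  have e2 := entropy_congr (P := P) (f := fun ω => ((fun j : (univ : Finset ι) => ω.1 j), W ω))
    (g := fun ω => ((fun c => v (ω.2 c).1), ω.1)) (by
      intro ω ω'
      simp only [Prod.mk.injEq, funext_iff, Subtype.forall, mem_univ, forall_const, W, hv.eq_iff]
      tauto)
  have e3 := entropy_congr (P := P) (f := fun ω => ((fun j : A => ω.1 j), W ω))
    (g := fun ω => ((fun c => v (ω.2 c).1), fun j : A => ω.1 j)) (by
      intro ω ω'
      simp only [Prod.mk.injEq, funext_iff, W, hv.eq_iff]
      tauto)
  rw [e1, e2, e3]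
  ring

omit [Fintype U] in
theorem obsInfo_const (A : Finset ι) (e : γ) : obsInfo p K enc A (fun _ _ => e) = 0 := by
  unfold obsInfo
  have e1 := entropy_congr (P := seqLaw p K enc)
    (f := fun ω => ((fun _ : κ => e), fun j : A => ω.1 j)) (g := fun ω (j : A) => ω.1 j) (by simp)
  have e2 := entropy_congr (P := seqLaw p K enc)
    (f := fun ω => ((fun _ : κ => e), ω.1)) (g := fun ω => ω.1) (by simp)
  rw [e1, e2]
  simp

/-- The converse without secrecy: the letters outside `A` are described by the channel uses that
are not functions of the letters in `A`. -/
theorem sum_letterInfo_le_capacity (hp : p ∈ stdSimplex ℝ X) (hK : IsWiretapChannel K)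
    (A : Finset ι) (dec : (κ → V) → ι → Y) (E : Finset κ)
    (hE : ∀ c ∈ E, ∃ u : (A → X) → U, ∀ x, enc c x = u fun j => x j) :
    ∑ i ∈ Aᶜ, (entropy (seqLaw p K enc) (fun ω => ω.1 i)
        + entropy (seqLaw p K enc) (fun ω => dec (fun c => (ω.2 c).1) i)
        - entropy (seqLaw p K enc) (fun ω => (ω.1 i, dec (fun c => (ω.2 c).1) i)))
      ≤ #Eᶜ * (capacity K * Real.log 2) := by
  refine (sum_letterInfo_le_obsInfo hp hK A dec some (Option.some_injective V)).trans ?_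
  -- The extra symbol `none` is an erased output. Erasing costs at most C outside E and nothing in
  -- E.
  have h := sub_le_sum_of_update (fun o => obsInfo p K enc A o) (fun _ _ => none)
    (fun _ y => some y.1) (fun c => if c ∈ Eᶜ then capacity K * Real.log 2 else 0) (by
      intro o c
      by_cases hc : c ∈ E
      · obtain ⟨u, hu⟩ := hE c hc
        rw [obsInfo_step_zero hp hK A o c u hu (fun y => some y.1) none, sub_self]
        simp [hc]
      · rw [if_pos (mem_compl.2 hc)]
        exact obsInfo_step_capacity hp hK A o c none some (Option.some_injective V))
  rw [sum_ite_mem, univ_inter, sum_const, nsmul_eq_mul] at h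
  simp only [obsInfo_const, sub_zero] at h
  exact h

/-- The converse with secrecy. -/
theorem sum_letterInfo_le_secrecy (hp : p ∈ stdSimplex ℝ X) (hK : IsWiretapChannel K)
    (A B : Finset ι) (dec : (κ → V) → ι → Y) (E D : Finset κ) (hED : E ⊆ D)
    (hE : ∀ c ∈ E, ∃ u : (A → X) → U, ∀ x, enc c x = u fun j => x j)
    (hD : ∀ c ∈ D, ∃ u : (B → X) → U, ∀ x, enc c x = u fun j => x j) :
    ∑ i ∈ Aᶜ, (entropy (seqLaw p K enc) (fun ω => ω.1 i)
        + entropy (seqLaw p K enc) (fun ω => dec (fun c => (ω.2 c).1) i)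
        - entropy (seqLaw p K enc) (fun ω => (ω.1 i, dec (fun c => (ω.2 c).1) i)))
      ≤ #Dᶜ * (capacity K * Real.log 2) + #(D \ E) * (secrecyCapacity K * Real.log 2)
        + (entropy (seqLaw p K enc) (fun ω (j : B) => ω.1 j)
          + entropy (seqLaw p K enc) (fun ω (c : D) => (ω.2 c).2)
          - entropy (seqLaw p K enc)
            (fun ω => ((fun j : B => ω.1 j), fun c : D => (ω.2 c).2))) := by
  have hP := seqLaw_mem_stdSimplex (enc := enc) hp hK
  -- An observation in `Option (V ⊕ Z)` is the legitimate output, the eavesdropper's output, or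
  -- nothing.
  have hl : Function.Injective fun v : V => some (Sum.inl v : V ⊕ Z) := fun a b h => by simpa using h
  have hr : Function.Injective fun z : Z => some (Sum.inr z : V ⊕ Z) := fun a b h => by simpa using h
  refine (sum_letterInfo_le_obsInfo hp hK A dec _ hl).trans ?_
  obtain ⟨oZ, hoD, hoN⟩ : ∃ oZ : κ → V × Z → Option (V ⊕ Z),
      (∀ c ∈ D, oZ c = fun y => some (Sum.inr y.2)) ∧ ∀ c ∉ D, oZ c = fun _ => none :=
    ⟨fun c => if c ∈ D then fun y => some (Sum.inr y.2) else fun _ => none,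
      fun c hc => if_pos hc, fun c hc => if_neg hc⟩
  have h := sub_le_sum_of_update (fun o => obsInfo p K enc A o) oZ
    (fun _ y => some (Sum.inl y.1)) (fun c => (if c ∈ Dᶜ then capacity K * Real.log 2 else 0) +
      (if c ∈ D \ E then secrecyCapacity K * Real.log 2 else 0)) (by
      intro o c
      by_cases hcE : c ∈ E
      · obtain ⟨u, hu⟩ := hE c hcE
        rw [obsInfo_step_zero hp hK A o c u hu (fun y => some (Sum.inl y.1)) none,
          obsInfo_step_zero hp hK A o c u hu (oZ c) none]
        simp [hcE, hED hcE]
      · by_cases hcD : c ∈ D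
        · rw [hoD c hcD, if_neg (by simp [hcD]), if_pos (by simp [hcD, hcE]), zero_add]
          exact obsInfo_step_secrecy hp hK A o c (fun v => some (Sum.inl v)) hl
            (fun z => some (Sum.inr z)) hr
        · rw [hoN c hcD, if_pos (by simp [hcD]), if_neg (by simp [hcD]), add_zero]
          exact obsInfo_step_capacity hp hK A o c none (fun v => some (Sum.inl v)) hl)
  -- The inputs in D are functions of the letters in B, so I(X; Z_D | X_B) ≤ 0. This bounds I(X;
  -- Z_D) by the leakage I(X_B; Z_D).
  have hz := sub_le_sum_of_update (fun o => obsInfo p K enc B o)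
    (fun _ _ => none) oZ (fun c => 0) (by
      intro o c
      by_cases hcD : c ∈ D
      · obtain ⟨u, hu⟩ := hD c hcD
        rw [obsInfo_step_zero hp hK B o c u hu (oZ c) none, sub_self]
      · simp [hoN c hcD])
  simp only [obsInfo_const, sum_const_zero, sub_zero] at hz
  rw [sum_add_distrib, sum_ite_mem, sum_ite_mem, univ_inter, univ_inter, sum_const, sum_const,
    nsmul_eq_mul, nsmul_eq_mul] at h
  -- This gives I(X; Z_D | X_A) ≤ I(X; Z_D), as X_A is a function of X.
  have hsub := entropy_prod_le hP (fun ω c => oZ c (ω.2 c)) (fun ω (j : A) => ω.1 j)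
  have hoZ : ∀ y y' : κ → V × Z, ((fun c => oZ c (y c)) = fun c => oZ c (y' c)) ↔
      (fun c : D => (y c).2) = fun c : D => (y' c).2 := by
    intro y y'
    simp only [funext_iff, Subtype.forall]
    refine forall_congr' fun c => ?_
    by_cases hc : c ∈ D
    · simp [hc, hoD c hc]
    · simp [hc, hoN c hc]
  have e1 := entropy_congr (P := seqLaw p K enc) (f := fun ω c => oZ c (ω.2 c))
    (g := fun ω (c : D) => (ω.2 c).2) (fun ω ω' => hoZ _ _)
  have e2 := entropy_congr (P := seqLaw p K enc)
    (f := fun ω => ((fun c => oZ c (ω.2 c)), fun j : B => ω.1 j))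
    (g := fun ω => ((fun j : B => ω.1 j), fun c : D => (ω.2 c).2)) (fun ω ω' => by
      simp only [Prod.mk.injEq, hoZ]; tauto)
  unfold obsInfo at h hz
  dsimp only at h hz
  unfold obsInfo
  linarith

end Converse
-- The converse bounds for the blocks of a code.
namespace Code

variable {X Y U V Z : Type*} {G : ℝ → ℝ} {k n : ℕ} [Fintype X] [Fintype V] [Fintype Z]

/-- The probability space of a code with the letters and the channel uses listed one by one. -/
def flatten (X W : Type*) (G : ℝ → ℝ) (k n : ℕ) :
    ((Fin k × Fin n → X) × ((Σ i : Fin k, Fin (blockLen G k n i)) → W)) ≃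
      ((Fin k → Fin n → X) × ChannelSeq G k n W) :=
  Equiv.prodCongr (Equiv.curry (Fin k) (Fin n) X)
    (Equiv.piCurry (fun (i : Fin k) (_ : Fin (blockLen G k n i)) => W))

/-- The encoder at one channel use as a function of the whole source. -/
def encAt (c : Code X Y U V G k n) (s : Σ i : Fin k, Fin (blockLen G k n i))
    (x : Fin k × Fin n → X) : U :=
  c.enc s.1 (fun j t => x (j, t)) s.2

/-- The decoder with the letters and the channel uses listed one by one. -/
def decAt (c : Code X Y U V G k n) (v : (Σ i : Fin k, Fin (blockLen G k n i)) → V)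
    (i : Fin k × Fin n) : Y :=
  c.dec (fun j s => v ⟨j, s⟩) i.1 i.2

omit [Fintype X] [Fintype V] [Fintype Z] in
theorem jointLaw_flatten (c : Code X Y U V G k n) (p : X → ℝ) (K : U → V × Z → ℝ) :
    (fun ω => c.jointLaw p K (flatten X (V × Z) G k n ω)) = seqLaw p K c.encAt := by
  funext ω
  simp only [jointLaw, seqLaw, Fintype.prod_prod_type, Fintype.prod_sigma]
  rfl

theorem jointLaw_mem_stdSimplex (c : Code X Y U V G k n) {p : X → ℝ} {K : U → V × Z → ℝ}
    (hp : p ∈ stdSimplex ℝ X) (hK : IsWiretapChannel K) :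
    c.jointLaw p K ∈ stdSimplex ℝ ((Fin k → Fin n → X) × ChannelSeq G k n (V × Z)) := by
  have h := seqLaw_mem_stdSimplex (enc := c.encAt) hp hK
  rw [← jointLaw_flatten] at h
  refine ⟨fun ω => by simpa using h.1 ((flatten X (V × Z) G k n).symm ω), ?_⟩
  rw [← (flatten X (V × Z) G k n).sum_comp]
  exact h.2

theorem entropy_flatten {β : Type*} (c : Code X Y U V G k n) (p : X → ℝ) (K : U → V × Z → ℝ)
    (f : (Fin k → Fin n → X) × ChannelSeq G k n (V × Z) → β) :
    entropy (c.jointLaw p K) f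
      = entropy (seqLaw p K c.encAt) (fun ω => f (flatten X (V × Z) G k n ω)) := by
  rw [← jointLaw_flatten, entropy_equiv]

/-- The information, in bits, between a source letter and its reconstruction. -/
noncomputable def letterRate (c : Code X Y U V G k n) (p : X → ℝ) (K : U → V × Z → ℝ) (i : Fin k)
    (t : Fin n) : ℝ :=
  (entropy (c.jointLaw p K) (fun ω => ω.1 i t)
    + entropy (c.jointLaw p K) (fun ω => c.dec (fun j s => (ω.2 j s).1) i t)
    - entropy (c.jointLaw p K) (fun ω => (ω.1 i t, c.dec (fun j s => (ω.2 j s).1) i t)))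
    / Real.log 2

omit [Fintype X] [Fintype V] [Fintype Z] in
-- Causality of the encoder: this is where the sequential structure of the code enters.
theorem encAt_eq (c : Code X Y U V G k n) (A : Finset (Fin k × Fin n))
    (s : Σ i : Fin k, Fin (blockLen G k n i)) (h : ∀ j ≤ s.1, ∀ t, (j, t) ∈ A) :
    ∃ u : (A → X) → U, ∀ x, c.encAt s x = u fun j => x j :=
  ⟨fun a => c.enc s.1 (fun j t => a ⟨(j, t), h j j.2 t⟩) s.2, fun _ => rfl⟩

theorem card_sigma_filter (q : Fin k → Prop) [DecidablePred q] :
    (#(univ.filter fun s : (Σ i : Fin k, Fin (blockLen G k n i)) => q s.1) : ℝ)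
      = ∑ i with q i, (blockLen G k n i : ℝ) := by
  have : (univ.filter fun s : (Σ i : Fin k, Fin (blockLen G k n i)) => q s.1)
      = (univ.filter q).sigma fun _ => univ := by
    ext s; simp
  rw [this, card_sigma]
  simp

/-- The letters of a code from the block `m` on, flattened. -/
theorem sum_letterRate_eq (c : Code X Y U V G k n) (p : X → ℝ) (K : U → V × Z → ℝ) (m : ℕ) :
    ∑ i ∈ univ.filter (fun i : Fin k => m ≤ (i : ℕ)), ∑ t, c.letterRate p K i t =
      (∑ i ∈ (univ.filter fun i : Fin k × Fin n => (i.1 : ℕ) < m)ᶜ,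
        (entropy (seqLaw p K c.encAt) (fun ω => ω.1 i)
        + entropy (seqLaw p K c.encAt)
          (fun ω => c.decAt (fun s => (ω.2 s).1) i)
        - entropy (seqLaw p K c.encAt) (fun ω => (ω.1 i,
          c.decAt (fun s => (ω.2 s).1) i)))) / Real.log 2 := by
  have : (univ.filter fun i : Fin k × Fin n => (i.1 : ℕ) < m)ᶜ
      = (univ.filter fun i : Fin k => m ≤ (i : ℕ)) ×ˢ univ := by
    ext s; simp
  rw [this, sum_product, sum_div]
  refine sum_congr rfl fun i _ => ?_
  rw [sum_div]
  refine sum_congr rfl fun t _ => ?_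
  simp only [letterRate, entropy_flatten]
  rfl

variable [Fintype U] {p : X → ℝ} {K : U → V × Z → ℝ}

theorem sum_letterRate_le_capacity (c : Code X Y U V G k n) (hp : p ∈ stdSimplex ℝ X)
    (hK : IsWiretapChannel K) (m : ℕ) :
    ∑ i ∈ univ.filter (fun i : Fin k => m ≤ (i : ℕ)), ∑ t, c.letterRate p K i t
      ≤ (∑ i ∈ univ.filter (fun i : Fin k => m ≤ (i : ℕ)), (blockLen G k n i : ℝ)) * capacity K := by
  rw [sum_letterRate_eq, div_le_iff₀ (Real.log_pos one_lt_two)]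
  refine (sum_letterInfo_le_capacity hp hK _ c.decAt (univ.filter fun s => (s.1 : ℕ) < m) ?_).trans ?_
  · intro s hs
    refine c.encAt_eq _ s fun j hj t => ?_
    simp only [mem_filter, mem_univ, true_and] at hs ⊢
    exact lt_of_le_of_lt hj hs
  · rw [compl_filter, card_sigma_filter (fun i : Fin k => ¬ (i : ℕ) < m), mul_assoc]
    simp only [not_lt, le_refl]

/-- Here A and E are the letters and channel uses before block m, and B and D are those up to block
j. The hypothesis `hmj` ensures E ⊆ D. -/
theorem sum_letterRate_le_secrecy (c : Code X Y U V G k n) (hp : p ∈ stdSimplex ℝ X)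
    (hK : IsWiretapChannel K) (m : ℕ) (j : Fin k) (hmj : m ≤ (j : ℕ) + 1) :
    ∑ i ∈ univ.filter (fun i : Fin k => m ≤ (i : ℕ)), ∑ t, c.letterRate p K i t
      ≤ (∑ i ∈ univ.filter (fun i : Fin k => j < i), (blockLen G k n i : ℝ)) * capacity K
        + (∑ i ∈ univ.filter (fun i : Fin k => m ≤ (i : ℕ) ∧ i ≤ j), (blockLen G k n i : ℝ))
          * secrecyCapacity K
        + c.leakage p K j := by
  have hl : c.leakage p K j * Real.log 2
      = entropy (seqLaw p K c.encAt)
          (fun ω (i : (univ.filter fun i : Fin k × Fin n => i.1 ≤ j)) => ω.1 i)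
        + entropy (seqLaw p K c.encAt) (fun ω (s : (univ.filter fun s :
          (Σ i : Fin k, Fin (blockLen G k n i)) => s.1 ≤ j)) => (ω.2 s).2)
        - entropy (seqLaw p K c.encAt) (fun ω =>
          ((fun i : (univ.filter fun i : Fin k × Fin n => i.1 ≤ j) => ω.1 i), fun s : (univ.filter
          fun s : (Σ i : Fin k, Fin (blockLen G k n i)) => s.1 ≤ j) => (ω.2 s).2)) := by
    rw [leakage, mutualInfo_eq (c.jointLaw_mem_stdSimplex hp hK).1,
      div_mul_cancel₀ _ (Real.log_pos one_lt_two).ne', entropy_flatten, entropy_flatten,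
      entropy_flatten]
    have h1 : ∀ x x' : Fin k × Fin n → X,
        ((fun (i : {i : Fin k // i ≤ j}) t => x (i, t)) = fun (i : {i : Fin k // i ≤ j}) t => x' (i, t)) ↔
        (fun i : (univ.filter fun i : Fin k × Fin n => i.1 ≤ j) => x i) =
          fun i : (univ.filter fun i : Fin k × Fin n => i.1 ≤ j) => x' i := by
      intro x x'
      simp only [funext_iff, Subtype.forall, mem_filter, mem_univ, true_and, Prod.forall]
      exact ⟨fun h a b hab => h a hab b, fun h a hab b => h a b hab⟩
    have h2 : ∀ y y' : (Σ i : Fin k, Fin (blockLen G k n i)) → V × Z,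
        ((fun (i : {i : Fin k // i ≤ j}) (t : Fin (blockLen G k n i)) => (y ⟨i, t⟩).2)
          = fun (i : {i : Fin k // i ≤ j}) (t : Fin (blockLen G k n i)) => (y' ⟨i, t⟩).2) ↔
        (fun s : (univ.filter fun s : (Σ i : Fin k, Fin (blockLen G k n i)) => s.1 ≤ j) =>
          (y s).2) = fun s : (univ.filter fun s : (Σ i : Fin k, Fin (blockLen G k n i)) => s.1 ≤ j) =>
          (y' s).2 := by
      intro y y'
      simp only [funext_iff, Subtype.forall, mem_filter, mem_univ, true_and, Sigma.forall]
      exact ⟨fun h a b hab => h a hab b, fun h a hab b => h a b hab⟩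
    congr 1
    · congr 1
      · exact entropy_congr fun ω ω' => h1 ω.1 ω'.1
      · exact entropy_congr fun ω ω' => h2 ω.2 ω'.2
    · exact entropy_congr fun ω ω' => by
        simp only [Prod.mk.injEq]
        exact and_congr (h1 ω.1 ω'.1) (h2 ω.2 ω'.2)
  rw [sum_letterRate_eq, div_le_iff₀ (Real.log_pos one_lt_two), add_mul, hl]
  refine (sum_letterInfo_le_secrecy hp hK _ (univ.filter fun i : Fin k × Fin n => i.1 ≤ j)
    c.decAt
    (univ.filter fun s => (s.1 : ℕ) < m) (univ.filter fun s => s.1 ≤ j) ?_ ?_ ?_).trans ?_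
  · intro s hs
    simp only [mem_filter, mem_univ, true_and, Fin.le_def] at hs ⊢
    omega
  · intro s hs
    refine c.encAt_eq _ s fun j hj t => ?_
    simp only [mem_filter, mem_univ, true_and] at hs ⊢
    exact lt_of_le_of_lt hj hs
  · intro s hs
    refine c.encAt_eq _ s fun j hj t => ?_
    simp only [mem_filter, mem_univ, true_and] at hs ⊢
    exact hj.trans hs
  · have h3 : (univ.filter fun s : (Σ i : Fin k, Fin (blockLen G k n i)) => s.1 ≤ j) \
        (univ.filter fun s => (s.1 : ℕ) < m) = univ.filter fun s => m ≤ (s.1 : ℕ) ∧ s.1 ≤ j := by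
      ext s; simp [and_comm]
    rw [compl_filter, card_sigma_filter (fun i : Fin k => ¬ i ≤ j), h3,
      card_sigma_filter (fun i : Fin k => m ≤ (i : ℕ) ∧ i ≤ j)]
    simp only [not_le, add_mul, mul_assoc]
    exact le_rfl

end Code

/-! ### Convexity and right-continuity of the distortion-rate function. -/

section RateDistortion

variable {Ω X Y : Type*} [Fintype Ω] [Fintype X] {p : X → ℝ} {d : X → Y → ℝ≥0∞}

theorem sum_ofReal_law_mul {β : Type*} [Fintype β] {P : Ω → ℝ} (hP : ∀ ω, 0 ≤ P ω) (f : Ω → β)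
    (F : β → ℝ≥0∞) :
    ∑ b, ENNReal.ofReal (law P f b) * F b = ∑ ω, ENNReal.ofReal (P ω) * F (f ω) := by
  classical
  have : ∀ b, ENNReal.ofReal (law P f b) * F b
      = ∑ ω, if f ω = b then ENNReal.ofReal (P ω) * F b else 0 := by
    intro b
    rw [law, ENNReal.ofReal_sum_of_nonneg fun ω _ => by split_ifs <;> simp [hP], sum_mul]
    refine sum_congr rfl fun ω _ => ?_
    split_ifs <;> simp
  simp only [this]
  rw [sum_comm]
  simp

/-- Any pair of random variables with the law of the source in the first component gives a test
channel. -/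
theorem rateDistortion_le (d : X → Y → ℝ≥0∞) {P : Ω → ℝ} (hP : P ∈ stdSimplex ℝ Ω) (f : Ω → X)
    (g : Ω → Y) (hf : ∀ x, law P f x = p x) :
    rateDistortion p d (∑ ω, ENNReal.ofReal (P ω) * d (f ω) (g ω)) ≤ ENNReal.ofReal
      ((entropy P f + entropy P g - entropy P (fun ω => (f ω, g ω))) / Real.log 2) := by
  classical
  let S : Finset Y := univ.image g
  let g' : Ω → S := fun ω => ⟨g ω, mem_image_of_mem g (mem_univ ω)⟩
  -- The conditional law of g given f = x. Where p x = 0 any distribution will do; the marginal of g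
  -- is used.
  let Q : X → S → ℝ := fun x y =>
    if p x = 0 then law P g' y else law P (fun ω => (f ω, g' ω)) (x, y) / p x
  have hmarg : ∀ x, ∑ y, law P (fun ω => (f ω, g' ω)) (x, y) = p x := by
    intro x
    rw [← hf, ← sum_law_left P g' f x]
    exact sum_congr rfl fun y _ => law_eq_of_iff fun ω => by simp only [Prod.mk.injEq]; tauto
  have hQ : ∀ x, Q x ∈ stdSimplex ℝ S := by
    intro x
    by_cases hx : p x = 0
    · simp only [Q, hx, if_true]
      exact law_mem_stdSimplex hP g'
    · simp only [Q, hx, if_false]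
      refine ⟨fun y => div_nonneg (law_nonneg hP.1 _ _) (hf x ▸ law_nonneg hP.1 _ _), ?_⟩
      rw [← sum_div, hmarg, div_self hx]
  have hpQ : ∀ x y, p x * Q x y = law P (fun ω => (f ω, g' ω)) (x, y) := by
    intro x y
    by_cases hx : p x = 0
    · have := hmarg x
      rw [hx, sum_eq_zero_iff_of_nonneg fun y _ => law_nonneg hP.1 _ _] at this
      rw [this y (mem_univ y), hx, zero_mul]
    · simp only [Q, hx, if_false]
      field_simp
  refine iInf_le_of_le S (iInf_le_of_le Q (iInf_le_of_le hQ (iInf_le_of_le ?_ (le_of_eq ?_))))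
  · simp only [hpQ]
    rw [← Fintype.sum_prod_type' (f := fun x (y : S) =>
      ENNReal.ofReal (law P (fun ω => (f ω, g' ω)) (x, y)) * d x y)]
    exact (sum_ofReal_law_mul hP.1 (fun ω => (f ω, g' ω)) (fun b => d b.1 b.2)).le
  · have hj : (fun ω : X × S => p ω.1 * Q ω.1 ω.2) = law P (fun ω => (f ω, g' ω)) :=
      funext fun ω => hpQ _ _
    rw [hj, mutualInfo_eq (law_nonneg hP.1 _)]
    have h0 : ∀ b, law (law P fun ω => (f ω, g' ω)) id b = law P (fun ω => (f ω, g' ω)) b :=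
      fun b => (law_comp P (fun ω => (f ω, g' ω)) id b).symm
    have e1 := entropy_comp_eq_of_law_eq h0 Prod.fst
    have e2 := entropy_comp_eq_of_law_eq h0 Prod.snd
    have e3 := entropy_comp_eq_of_law_eq h0 (fun b => (b.1, b.2))
    have e4 := entropy_congr (P := P) (f := g') (g := g) (by simp [g'])
    have e5 := entropy_congr (P := P) (f := fun ω => (f ω, g' ω)) (g := fun ω => (f ω, g ω))
      (by simp [g'])
    simp only [id] at e1 e2 e3
    have e1' : entropy (law P fun ω => (f ω, g' ω)) Prod.fst = entropy P f := e1
    have e2' : entropy (law P fun ω => (f ω, g' ω)) Prod.snd = entropy P g' := e2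
    rw [e1', e2', e3, e4, e5]

theorem rateDistortion_antitone : Antitone (rateDistortion p d) := by
  intro D D' h
  unfold rateDistortion
  exact iInf_mono fun S => iInf_mono fun Q => iInf_mono fun hQ =>
    iInf_mono' fun hd => ⟨hd.trans h, le_rfl⟩

theorem distortionRate_antitone : Antitone (distortionRate p d) := by
  intro R R' h
  exact sInf_le_sInf fun D hD => le_trans (α := ℝ≥0∞) hD h

theorem rateDistortion_le_of_lt {R D : ℝ≥0∞} (h : distortionRate p d R < D) :
    rateDistortion p d D ≤ R := by
  obtain ⟨D', hD', hlt⟩ := sInf_lt_iff.1 h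
  exact (rateDistortion_antitone hlt.le).trans hD'

/-- Right-continuity: a distortion above all the values D(R + 1/(m+1)) needs rate at most R +
1/(m+1) for every m, hence at most R. -/
theorem distortionRate_eq_iSup (R : ℝ≥0∞) :
    distortionRate p d R = ⨆ m : ℕ, distortionRate p d (R + ((m : ℝ≥0∞) + 1)⁻¹) := by
  refine le_antisymm (le_of_forall_gt_imp_ge_of_dense fun D hD => ?_)
    (iSup_le fun m => distortionRate_antitone le_self_add)
  refine sInf_le ?_
  change rateDistortion p d D ≤ R
  have h : ∀ m : ℕ, rateDistortion p d D ≤ R + ((m : ℝ≥0∞) + 1)⁻¹ := fun m =>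
    rateDistortion_le_of_lt ((le_iSup (fun m : ℕ => distortionRate p d (R + ((m : ℝ≥0∞) + 1)⁻¹))
      m).trans_lt hD)
  have ht : Filter.Tendsto (fun m : ℕ => R + ((m : ℝ≥0∞) + 1)⁻¹) Filter.atTop (nhds (R + 0)) := by
    refine Filter.Tendsto.add tendsto_const_nhds ?_
    have := (Filter.tendsto_add_atTop_iff_nat 1).2 ENNReal.tendsto_inv_nat_nhds_zero
    simpa using this
  rw [add_zero] at ht
  exact ge_of_tendsto' ht h

section Mix

variable {Ω₁ Ω₂ β γ : Type*} [Fintype Ω₁] [Fintype Ω₂] {P₁ : Ω₁ → ℝ} {P₂ : Ω₂ → ℝ} {a b : ℝ}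

/-- The mixture of two laws. -/
def mix (a b : ℝ) (P₁ : Ω₁ → ℝ) (P₂ : Ω₂ → ℝ) : Ω₁ ⊕ Ω₂ → ℝ :=
  Sum.elim (fun ω => a * P₁ ω) (fun ω => b * P₂ ω)

theorem mix_mem_stdSimplex (ha : 0 ≤ a) (hb : 0 ≤ b) (hab : a + b = 1)
    (h₁ : P₁ ∈ stdSimplex ℝ Ω₁) (h₂ : P₂ ∈ stdSimplex ℝ Ω₂) :
    mix a b P₁ P₂ ∈ stdSimplex ℝ (Ω₁ ⊕ Ω₂) := by
  refine ⟨?_, ?_⟩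
  · rintro (ω | ω)
    · exact mul_nonneg ha (h₁.1 ω)
    · exact mul_nonneg hb (h₂.1 ω)
  · simp [mix, ← mul_sum, h₁.2, h₂.2, hab]

theorem law_mix (g : Ω₁ ⊕ Ω₂ → γ) (c : γ) : law (mix a b P₁ P₂) g c
    = a * law P₁ (fun ω => g (Sum.inl ω)) c + b * law P₂ (fun ω => g (Sum.inr ω)) c := by
  classical
  simp [law, mix, mul_sum]

theorem entropy_mix (ha : 0 < a) (hb : 0 < b)
    (h₁ : P₁ ∈ stdSimplex ℝ Ω₁) (h₂ : P₂ ∈ stdSimplex ℝ Ω₂) (g : Ω₁ ⊕ Ω₂ → γ) :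
    entropy (mix a b P₁ P₂) (fun ω => (Sum.isLeft ω, g ω))
      = a * entropy P₁ (fun ω => g (Sum.inl ω)) + b * entropy P₂ (fun ω => g (Sum.inr ω))
        - a * Real.log a - b * Real.log b := by
  classical
  have l1 : ∀ ω, law (mix a b P₁ P₂) (fun ω => (Sum.isLeft ω, g ω)) (true, g (Sum.inl ω))
      = a * law P₁ (fun ω => g (Sum.inl ω)) (g (Sum.inl ω)) := by
    intro ω; simp [law, mix, mul_sum]
  have l2 : ∀ ω, law (mix a b P₁ P₂) (fun ω => (Sum.isLeft ω, g ω)) (false, g (Sum.inr ω))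
      = b * law P₂ (fun ω => g (Sum.inr ω)) (g (Sum.inr ω)) := by
    intro ω; simp [law, mix, mul_sum]
  have t1 : ∀ ω, a * P₁ ω * Real.log (a * law P₁ (fun ω => g (Sum.inl ω)) (g (Sum.inl ω)))
      = P₁ ω * (a * Real.log a)
        + a * (P₁ ω * Real.log (law P₁ (fun ω => g (Sum.inl ω)) (g (Sum.inl ω)))) := by
    intro ω
    rcases (h₁.1 ω).eq_or_lt with h | h
    · simp [← h]
    · have h := h.trans_le (le_law_self h₁.1 (fun ω => g (Sum.inl ω)) ω)
      rw [Real.log_mul ha.ne' h.ne']; ring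
  have t2 : ∀ ω, b * P₂ ω * Real.log (b * law P₂ (fun ω => g (Sum.inr ω)) (g (Sum.inr ω)))
      = P₂ ω * (b * Real.log b)
        + b * (P₂ ω * Real.log (law P₂ (fun ω => g (Sum.inr ω)) (g (Sum.inr ω)))) := by
    intro ω
    rcases (h₂.1 ω).eq_or_lt with h | h
    · simp [← h]
    · have h := h.trans_le (le_law_self h₂.1 (fun ω => g (Sum.inr ω)) ω)
      rw [Real.log_mul hb.ne' h.ne']; ring
  simp only [entropy, Fintype.sum_sum_type, Sum.isLeft_inl, Sum.isLeft_inr, l1, l2]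
  simp only [mix, Sum.elim_inl, Sum.elim_inr, t1, t2, sum_add_distrib, ← sum_mul, ← mul_sum,
    h₁.2, h₂.2]
  ring

/-- The mutual information is convex in the test channel. -/
theorem mutualInfo_mix_le [Fintype β] (ha : 0 < a) (hb : 0 < b) (hab : a + b = 1)
    (h₁ : P₁ ∈ stdSimplex ℝ Ω₁) (h₂ : P₂ ∈ stdSimplex ℝ Ω₂) (f : Ω₁ ⊕ Ω₂ → β) (g : Ω₁ ⊕ Ω₂ → γ)
    (hf : ∀ x, law P₁ (fun ω => f (Sum.inl ω)) x = law P₂ (fun ω => f (Sum.inr ω)) x) :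
    entropy (mix a b P₁ P₂) f + entropy (mix a b P₁ P₂) g
        - entropy (mix a b P₁ P₂) (fun ω => (f ω, g ω))
      ≤ a * (entropy P₁ (fun ω => f (Sum.inl ω)) + entropy P₁ (fun ω => g (Sum.inl ω))
          - entropy P₁ (fun ω => (f (Sum.inl ω), g (Sum.inl ω))))
        + b * (entropy P₂ (fun ω => f (Sum.inr ω)) + entropy P₂ (fun ω => g (Sum.inr ω))
          - entropy P₂ (fun ω => (f (Sum.inr ω), g (Sum.inr ω)))) := by
  have hP := mix_mem_stdSimplex ha.le hb.le hab h₁ h₂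
  have e1 : entropy (mix a b P₁ P₂) f = entropy P₁ (fun ω => f (Sum.inl ω)) :=
    entropy_eq_of_law_eq fun x => by rw [law_mix, ← hf, ← add_mul, hab, one_mul]
  have e2 : entropy P₂ (fun ω => f (Sum.inr ω)) = entropy P₁ (fun ω => f (Sum.inl ω)) :=
    (entropy_eq_of_law_eq hf).symm
  -- I(f; g) ≤ I(f; g, B) for the mixing bit B. Since B is independent of f, the right-hand side is
  -- the average of the two informations.
  have h := entropy_submodular hP.1 f (fun ω => Sum.isLeft ω) g
  have m1 := entropy_mix ha hb h₁ h₂ g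
  have m2 := entropy_mix ha hb h₁ h₂ (fun ω => (f ω, g ω))
  have c1 := entropy_congr (P := mix a b P₁ P₂) (f := fun ω => (f ω, Sum.isLeft ω, g ω))
    (g := fun ω => (Sum.isLeft ω, f ω, g ω)) (by intros; simp only [Prod.mk.injEq]; tauto)
  rw [e1, e2]
  have : a * entropy P₁ (fun ω => f (Sum.inl ω)) + b * entropy P₁ (fun ω => f (Sum.inl ω))
    = entropy P₁ (fun ω => f (Sum.inl ω)) := by rw [← add_mul, hab, one_mul]
  linarith

end Mix

theorem exists_channel_of_lt {D R : ℝ≥0∞} (h : rateDistortion p d D < R) :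
    ∃ (S : Finset Y) (Q : X → S → ℝ), (∀ x, Q x ∈ stdSimplex ℝ S) ∧
      ∑ x, ∑ y : S, ENNReal.ofReal (p x * Q x y) * d x y ≤ D ∧
      ENNReal.ofReal (mutualInfo (fun ω : X × S => p ω.1 * Q ω.1 ω.2) Prod.fst Prod.snd) < R := by
  simpa only [rateDistortion, iInf_lt_iff, exists_prop] using h

/-- Mix two test channels. Strict inequalities in the hypotheses supply the channels without
requiring that the infima be attained. -/
theorem rateDistortion_convex (hp : p ∈ stdSimplex ℝ X) {a b : ℝ} (ha : 0 < a) (hb : 0 < b)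
    (hab : a + b = 1) {D₁ D₂ R₁ R₂ : ℝ≥0∞} (h₁ : rateDistortion p d D₁ < R₁)
    (h₂ : rateDistortion p d D₂ < R₂) :
    rateDistortion p d (ENNReal.ofReal a * D₁ + ENNReal.ofReal b * D₂)
      ≤ ENNReal.ofReal a * R₁ + ENNReal.ofReal b * R₂ := by
  obtain ⟨S₁, Q₁, hQ₁, hd₁, hI₁⟩ := exists_channel_of_lt h₁
  obtain ⟨S₂, Q₂, hQ₂, hd₂, hI₂⟩ := exists_channel_of_lt h₂
  set P₁ : X × S₁ → ℝ := fun ω => p ω.1 * Q₁ ω.1 ω.2 with hP₁def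
  set P₂ : X × S₂ → ℝ := fun ω => p ω.1 * Q₂ ω.1 ω.2 with hP₂def
  have hP₁ : P₁ ∈ stdSimplex ℝ _ := kernel_mem_stdSimplex hp hQ₁
  have hP₂ : P₂ ∈ stdSimplex ℝ _ := kernel_mem_stdSimplex hp hQ₂
  have hP := mix_mem_stdSimplex ha.le hb.le hab hP₁ hP₂
  let f : (X × S₁) ⊕ (X × S₂) → X := Sum.elim Prod.fst Prod.fst
  let g : (X × S₁) ⊕ (X × S₂) → Y := Sum.elim (fun ω => ω.2) (fun ω => ω.2)
  have l1 : ∀ x, law P₁ (fun ω => f (Sum.inl ω)) x = p x := law_fst_kernel p hQ₁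
  have l2 : ∀ x, law P₂ (fun ω => f (Sum.inr ω)) x = p x := law_fst_kernel p hQ₂
  have hr := rateDistortion_le d hP f g (p := p) (by
    intro x; rw [law_mix, l1, l2, ← add_mul, hab, one_mul])
  refine (rateDistortion_antitone ?_).trans (hr.trans ?_)
  · simp only [Fintype.sum_sum_type, mix, Sum.elim_inl, Sum.elim_inr, ENNReal.ofReal_mul ha.le,
      ENNReal.ofReal_mul hb.le, mul_assoc, ← mul_sum, f, g, Fintype.sum_prod_type, P₁, P₂]
    gcongr
  · have hm := mutualInfo_mix_le ha hb hab hP₁ hP₂ f g (fun x => by rw [l1, l2])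
    rw [mutualInfo_eq hP₁.1] at hI₁
    rw [mutualInfo_eq hP₂.1] at hI₂
    have c1 := entropy_congr (P := P₁) (f := fun ω => g (Sum.inl ω)) (g := Prod.snd)
      (fun ω ω' => Subtype.ext_iff.symm)
    have c2 := entropy_congr (P := P₂) (f := fun ω => g (Sum.inr ω)) (g := Prod.snd)
      (fun ω ω' => Subtype.ext_iff.symm)
    have c3 := entropy_congr (P := P₁) (f := fun ω => (f (Sum.inl ω), g (Sum.inl ω)))
      (g := fun ω => (ω.1, ω.2)) (fun ω ω' => by
        simp only [f, g, Sum.elim_inl, Prod.mk.injEq, Subtype.ext_iff])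
    have c4 := entropy_congr (P := P₂) (f := fun ω => (f (Sum.inr ω), g (Sum.inr ω)))
      (g := fun ω => (ω.1, ω.2)) (fun ω ω' => by
        simp only [f, g, Sum.elim_inr, Prod.mk.injEq, Subtype.ext_iff])
    have c5 : entropy P₁ (fun ω => f (Sum.inl ω)) = entropy P₁ Prod.fst := rfl
    have c6 : entropy P₂ (fun ω => f (Sum.inr ω)) = entropy P₂ Prod.fst := rfl
    rw [c1, c2, c3, c4, c5, c6] at hm
    have hlog := Real.log_pos one_lt_two
    refine (ENNReal.ofReal_le_ofReal (div_le_div_of_nonneg_right hm hlog.le)).trans ?_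
    rw [add_div, mul_div_assoc, mul_div_assoc]
    refine ENNReal.ofReal_add_le.trans ?_
    rw [ENNReal.ofReal_mul ha.le, ENNReal.ofReal_mul hb.le]
    gcongr

theorem distortionRate_convex (hp : p ∈ stdSimplex ℝ X) {a b : ℝ} (ha : 0 < a) (hb : 0 < b)
    (hab : a + b = 1) {R₁ R₂ : ℝ≥0∞} (s1 : R₁ ≠ ⊤) (s2 : R₂ ≠ ⊤) :
    distortionRate p d (ENNReal.ofReal a * R₁ + ENNReal.ofReal b * R₂)
      ≤ ENNReal.ofReal a * distortionRate p d R₁ + ENNReal.ofReal b * distortionRate p d R₂ := by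
  have hab' : ENNReal.ofReal a + ENNReal.ofReal b = 1 := by
    rw [← ENNReal.ofReal_add ha.le hb.le, hab, ENNReal.ofReal_one]
  have split : ∀ u v e : ℝ≥0∞, ENNReal.ofReal a * (u + e) + ENNReal.ofReal b * (v + e)
      = ENNReal.ofReal a * u + ENNReal.ofReal b * v + e := by
    intro u v e
    calc _ = ENNReal.ofReal a * u + ENNReal.ofReal b * v
          + (ENNReal.ofReal a + ENNReal.ofReal b) * e := by ring
      _ = _ := by rw [hab', one_mul]
  by_cases t1 : distortionRate p d R₁ = ⊤
  · simp [t1, ha]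
  by_cases t2 : distortionRate p d R₂ = ⊤
  · simp [t2, hb]
  -- The infima need not be attained: the slack ε in the distortion brings the rates down to R₁ and
  -- R₂, and the slack η below makes the inequalities strict.
  refine ENNReal.le_of_forall_pos_le_add fun ε hε _ => ?_
  have hε0 : (ε : ℝ≥0∞) ≠ 0 := by simpa using hε.ne'
  rw [← split]
  refine sInf_le ?_
  change rateDistortion p d _ ≤ _
  refine ENNReal.le_of_forall_pos_le_add fun η hη _ => ?_
  have hη0 : (η : ℝ≥0∞) ≠ 0 := by simpa using hη.ne'
  rw [← split]
  exact rateDistortion_convex hp ha hb hab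
    ((rateDistortion_le_of_lt (ENNReal.lt_add_right t1 hε0)).trans_lt
      (ENNReal.lt_add_right s1 hη0))
    ((rateDistortion_le_of_lt (ENNReal.lt_add_right t2 hε0)).trans_lt
      (ENNReal.lt_add_right s2 hη0))

/-- The distortion-rate function with real arguments and values. -/
noncomputable def realDistortionRate (p : X → ℝ) (d : X → Y → ℝ≥0∞) (R : ℝ) : ℝ :=
  (distortionRate p d (ENNReal.ofReal R)).toReal

theorem realDistortionRate_nonneg (R : ℝ) : 0 ≤ realDistortionRate p d R :=
  ENNReal.toReal_nonneg

section Finite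

variable (hD : ∀ R, distortionRate p d R ≠ ⊤)
include hD

theorem ofReal_realDistortionRate (R : ℝ) :
    ENNReal.ofReal (realDistortionRate p d R) = distortionRate p d (ENNReal.ofReal R) :=
  ENNReal.ofReal_toReal (hD _)

theorem realDistortionRate_antitone : Antitone (realDistortionRate p d) := fun _ _ h =>
  ENNReal.toReal_mono (hD _) (distortionRate_antitone (ENNReal.ofReal_le_ofReal h))

theorem realDistortionRate_convexOn (hp : p ∈ stdSimplex ℝ X) :
    ConvexOn ℝ (Set.Ici 0) (realDistortionRate p d) := by
  rw [convexOn_iff_forall_pos]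
  refine ⟨convex_Ici 0, fun x hx y hy a b ha hb hab => ?_⟩
  have h := distortionRate_convex (d := d) hp ha hb hab (R₁ := ENNReal.ofReal x)
    (R₂ := ENNReal.ofReal y) ENNReal.ofReal_ne_top ENNReal.ofReal_ne_top
  rw [← ENNReal.ofReal_mul ha.le, ← ENNReal.ofReal_mul hb.le,
    ← ENNReal.ofReal_add (mul_nonneg ha.le hx) (mul_nonneg hb.le hy),
    ← ofReal_realDistortionRate hD, ← ofReal_realDistortionRate hD,
    ← ofReal_realDistortionRate hD, ← ENNReal.ofReal_mul ha.le, ← ENNReal.ofReal_mul hb.le,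
    ← ENNReal.ofReal_add (mul_nonneg ha.le (realDistortionRate_nonneg x))
      (mul_nonneg hb.le (realDistortionRate_nonneg y))] at h
  rw [ENNReal.ofReal_le_ofReal_iff (by
    have := realDistortionRate_nonneg (p := p) (d := d) x
    have := realDistortionRate_nonneg (p := p) (d := d) y
    positivity)] at h
  exact h

end Finite

end RateDistortion

/-! ### The distortion of a code in terms of its letter rates. -/

namespace Code

variable {X Y U V Z : Type*} {G : ℝ → ℝ} {k n : ℕ} [Fintype X] [Fintype V] [Fintype Z]
  {p : X → ℝ} {K : U → V × Z → ℝ}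

theorem law_source_letter (c : Code X Y U V G k n) (hp : p ∈ stdSimplex ℝ X)
    (hK : IsWiretapChannel K) (i : Fin k) (t : Fin n) (x : X) :
    law (c.jointLaw p K) (fun ω => ω.1 i t) x = p x := by
  rw [← law_equiv (flatten X (V × Z) G k n), jointLaw_flatten]
  change law (seqLaw p K c.encAt) (fun ω => ω.1 (i, t)) x = p x
  rw [law_comp (seqLaw p K c.encAt) (fun ω => ω.1) (fun x => x (i, t)), law_seqLaw_source hK]
  have h := law_coord_kernel hp (i, t) (fun _ : Fin k × Fin n → X => ()) (fun _ _ _ => rfl) () x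
  have h1 : law (fun x : Fin k × Fin n → X => ∏ i, p (x i)) (fun _ => ()) () = 1 := by
    have := (prod_mem_stdSimplex (ι := Fin k × Fin n) (fun _ => hp)).2
    simpa [law] using this
  rw [h1, one_mul] at h
  rw [← h]
  exact law_eq_of_iff fun ω => by simp

theorem distortionRate_letterRate_le (c : Code X Y U V G k n) (hp : p ∈ stdSimplex ℝ X)
    (hK : IsWiretapChannel K) (d : X → Y → ℝ≥0∞) (i : Fin k) (t : Fin n) :
    distortionRate p d (ENNReal.ofReal (c.letterRate p K i t))
      ≤ ∑ ω, ENNReal.ofReal (c.jointLaw p K ω) *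
        d (ω.1 i t) (c.dec (fun j s => (ω.2 j s).1) i t) :=
  sInf_le (rateDistortion_le d (c.jointLaw_mem_stdSimplex hp hK) (fun ω => ω.1 i t)
    (fun ω => c.dec (fun j s => (ω.2 j s).1) i t) (c.law_source_letter hp hK i t))

theorem sum_distortionRate_le (c : Code X Y U V G k n) (hp : p ∈ stdSimplex ℝ X)
    (hK : IsWiretapChannel K) (d : X → Y → ℝ≥0∞) :
    ((n : ℝ≥0∞) * k)⁻¹ * ∑ i, ∑ t, distortionRate p d (ENNReal.ofReal (c.letterRate p K i t))
      ≤ c.expectedDistortion p K d := by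
  refine (mul_le_mul_right (sum_le_sum fun i _ => sum_le_sum fun t _ =>
    c.distortionRate_letterRate_le hp hK d i t) _).trans (le_of_eq ?_)
  unfold expectedDistortion
  simp only [mul_sum]
  rw [sum_congr rfl fun i _ => sum_comm, sum_comm]
  refine sum_congr rfl fun ω _ => sum_congr rfl fun i _ => sum_congr rfl fun t _ => ?_
  ring

theorem letterRate_nonneg (c : Code X Y U V G k n) (hp : p ∈ stdSimplex ℝ X)
    (hK : IsWiretapChannel K) (i : Fin k) (t : Fin n) : 0 ≤ c.letterRate p K i t := by
  have h := entropy_prod_le (c.jointLaw_mem_stdSimplex hp hK) (fun ω => ω.1 i t)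
    (fun ω => c.dec (fun j s => (ω.2 j s).1) i t)
  exact div_nonneg (by linarith) (Real.log_pos one_lt_two).le

end Code
-- Tail sums of the letter rates, and regularity of the effective profile.
section Tail

variable {X Y U V Z : Type*} [Fintype X] [Fintype U] [Fintype V] [Fintype Z] {G L : ℝ → ℝ}
  {p : X → ℝ} {K : U → V × Z → ℝ} {k n : ℕ}

theorem div_mem_Icc {m : ℕ} (hm : m ≤ k) : (m : ℝ) / k ∈ Set.Icc (0 : ℝ) 1 :=
  ⟨by positivity, div_le_one_of_le₀ (by exact_mod_cast hm) (by positivity)⟩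

/-- Rounding down only shortens the blocks, and the unrounded lengths telescope. -/
theorem sum_blockLen_le (hG : IsCRDF G) (k n : ℕ) {m l : ℕ} (hml : m ≤ l) (hl : l ≤ k)
    (q : Fin k → Prop) [DecidablePred q] (hq : ∀ i, q i → m ≤ (i : ℕ) ∧ (i : ℕ) < l) :
    ∑ i ∈ univ.filter q, (blockLen G k n i : ℝ) ≤ n * k * (G (l / k) - G (m / k)) := by
  let g : ℕ → ℝ := fun i => n * k * G (i / k)
  have hmono : ∀ i, i < k → g i ≤ g (i + 1) := by
    intro i hi
    refine mul_le_mul_of_nonneg_left (hG.mono (div_mem_Icc hi.le) (div_mem_Icc hi) ?_)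
      (by positivity)
    push_cast
    gcongr
    linarith
  have hb : ∀ i : Fin k, (blockLen G k n i : ℝ) ≤ g (i + 1) - g i := by
    intro i
    have h := hmono i i.2
    have e : (n : ℝ) * k * (G (((i : ℕ) + 1 : ℝ) / k) - G (((i : ℕ) : ℝ) / k))
        = g (i + 1) - g i := by
      simp only [g]; push_cast; ring
    rw [blockLen, e]
    exact Nat.floor_le (by linarith)
  calc ∑ i ∈ univ.filter q, (blockLen G k n i : ℝ)
      ≤ ∑ i ∈ univ.filter q, (g (i + 1) - g i) := sum_le_sum fun i _ => hb i
    _ = ∑ i ∈ (univ.filter q).map Fin.valEmbedding, (g (i + 1) - g i) := by rw [sum_map]; rfl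
    _ ≤ ∑ i ∈ Ico m l, (g (i + 1) - g i) := by
        refine sum_le_sum_of_subset_of_nonneg ?_ ?_
        · intro i hi
          simp only [mem_map, mem_filter, mem_univ, true_and, Fin.valEmbedding_apply] at hi
          obtain ⟨j, hj, rfl⟩ := hi
          exact mem_Ico.2 (hq j hj)
        · intro i hi _
          have := hmono i ((mem_Ico.1 hi).2.trans_le hl)
          linarith
    _ = g l - g m := sum_Ico_sub g hml
    _ = n * k * (G (l / k) - G (m / k)) := by simp only [g]; ring

/-- The value at `β` of the loss caused by the leakage constraint. -/
noncomputable def leakLoss (K : U → V × Z → ℝ) (G L : ℝ → ℝ) (β : ℝ) : ℝ :=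
  (capacity K - secrecyCapacity K) * G β - L β

theorem effOut_eq (α : ℝ) : effOut K G L α = max (secrecyCapacity K * G α)
    (capacity K * G α - sSup (leakLoss K G L '' Set.Icc (0 : ℝ) 1)) := rfl

/-- The rates from the block `m` on, for a code with leakage constraint. -/
theorem sum_letterRate_le_effOut (hp : p ∈ stdSimplex ℝ X) (hK : IsWiretapChannel K)
    (hG : IsCRDF G) (hL : IsCLDF L) (hk : 1 ≤ k) (hn : 1 ≤ n) (c : Code X Y U V G k n)
    (hc : ∀ i : Fin k, 1 / ((n : ℝ) * k) * c.leakage p K i ≤ L (((i : ℕ) + 1 : ℝ) / k))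
    {ε : ℝ} (hε : 0 ≤ ε) (j : Fin k) (hj : sSup (leakLoss K G L '' Set.Icc (0 : ℝ) 1) - ε
      ≤ leakLoss K G L (((j : ℕ) + 1 : ℝ) / k)) {m : ℕ} (hm : m ≤ k) :
    ∑ i ∈ univ.filter (fun i : Fin k => m ≤ (i : ℕ)), ∑ t, c.letterRate p K i t
      ≤ n * k * (effOut K G L 1 - effOut K G L (m / k) + ε) := by
  have hk0 : (0 : ℝ) < k := by exact_mod_cast hk
  have hnk : (0 : ℝ) < n * k := by
    have : (0 : ℝ) < n := by exact_mod_cast hn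
    positivity
  have hC := capacity_nonneg hK
  have hS := secrecyCapacity_nonneg hK
  have hSC := secrecyCapacity_le_capacity hK
  set s := sSup (leakLoss K G L '' Set.Icc (0 : ℝ) 1)
  have h1 : ∑ i ∈ univ.filter (fun i : Fin k => m ≤ (i : ℕ)), ∑ t, c.letterRate p K i t
      ≤ n * k * (capacity K * (G 1 - G (m / k))) := by
    refine (c.sum_letterRate_le_capacity hp hK m).trans ?_
    have := sum_blockLen_le hG k n hm le_rfl (fun i : Fin k => m ≤ (i : ℕ))
      (fun i hi => ⟨hi, i.2⟩)
    rw [div_self hk0.ne'] at this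
    nlinarith [mul_le_mul_of_nonneg_right this hC]
  have hjmem : (((j : ℕ) + 1 : ℝ) / k) ∈ Set.Icc (0 : ℝ) 1 := by
    have := div_mem_Icc (k := k) (m := j + 1) j.2
    push_cast at this
    exact this
  -- With β = (j + 1)/k, the bound is n k times C (G 1 - G β) + C_WT (G β - G (m/k)) + L β,
  -- rearranged.
  have h2 : ∑ i ∈ univ.filter (fun i : Fin k => m ≤ (i : ℕ)), ∑ t, c.letterRate p K i t
      ≤ n * k * (capacity K * G 1 - secrecyCapacity K * G (m / k)
        - leakLoss K G L (((j : ℕ) + 1 : ℝ) / k)) := by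
    by_cases hmj : m ≤ (j : ℕ) + 1
    · refine (c.sum_letterRate_le_secrecy hp hK m j hmj).trans ?_
      have b1 := sum_blockLen_le hG k n (m := j + 1) (l := k) j.2 le_rfl (fun i : Fin k => j < i)
        (fun i hi => ⟨hi, i.2⟩)
      have b2 := sum_blockLen_le hG k n hmj j.2 (fun i : Fin k => m ≤ (i : ℕ) ∧ i ≤ j)
        (fun i hi => ⟨hi.1, Nat.lt_succ_of_le hi.2⟩)
      rw [div_self hk0.ne'] at b1
      push_cast at b1 b2
      have b3 := hc j
      rw [one_div, inv_mul_le_iff₀ hnk] at b3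
      have := mul_le_mul_of_nonneg_right b1 hC
      have := mul_le_mul_of_nonneg_right b2 hS
      unfold leakLoss
      nlinarith
    -- If m/k lies beyond β, the bound without secrecy is already the stronger one, since G β ≤ G
    -- (m/k) and L β ≥ 0.
    · refine h1.trans (mul_le_mul_of_nonneg_left ?_ hnk.le)
      have hle : G (((j : ℕ) + 1 : ℝ) / k) ≤ G (m / k) := by
        refine hG.mono hjmem (div_mem_Icc hm) ?_
        gcongr
        exact_mod_cast (not_le.1 hmj).le
      have := hL.nonneg _ hjmem
      unfold leakLoss
      nlinarith [mul_le_mul_of_nonneg_left hle (sub_nonneg.2 hSC)]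
  have hE1 : capacity K * G 1 - s ≤ effOut K G L 1 := le_max_right _ _
  -- The bound with secrecy serves the first branch at m/k, the bound without it the second. At 1
  -- the second branch suffices as a lower bound.
  rcases max_choice (secrecyCapacity K * G (m / k)) (capacity K * G (m / k) - s) with h | h
  · refine h2.trans (mul_le_mul_of_nonneg_left ?_ hnk.le)
    rw [effOut_eq (m / k : ℝ), h]
    linarith
  · refine h1.trans (mul_le_mul_of_nonneg_left ?_ hnk.le)
    rw [effOut_eq (m / k : ℝ), h]
    linarith

/-- The supremum of the loss is approached on fine grids. -/
theorem exists_grid_leakLoss (hG : IsCRDF G) (hL : IsCLDF L)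
    {ε : ℝ} (hε : 0 < ε) : ∀ᶠ k : ℕ in Filter.atTop, ∃ j : Fin k,
      sSup (leakLoss K G L '' Set.Icc (0 : ℝ) 1) - ε ≤ leakLoss K G L (((j : ℕ) + 1 : ℝ) / k) := by
  obtain ⟨_, ⟨β, hβ, rfl⟩, hlt⟩ := exists_lt_of_lt_csSup
    ((Set.nonempty_Icc.2 zero_le_one).image (leakLoss K G L)) (sub_lt_self _ hε)
  rcases hβ.2.eq_or_lt with h1 | h1
  · subst h1
    filter_upwards [Filter.eventually_ge_atTop 1] with k hk
    have hk0 : (k : ℝ) ≠ 0 := by positivity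
    refine ⟨⟨k - 1, by omega⟩, ?_⟩
    have : (((k - 1 : ℕ) : ℝ) + 1) / k = 1 := by
      rw [← Nat.cast_succ, Nat.succ_eq_add_one, Nat.sub_add_cancel hk, div_self hk0]
    rw [this]
    exact hlt.le
  -- The loss stays nearly optimal just to the right of β, and for large k the grid point (⌊β k⌋ +
  -- 1)/k lies there.
  · have hc : ContinuousWithinAt (leakLoss K G L) (Set.Ioi β) β :=
      ((hG.right_cont β ⟨hβ.1, h1⟩).const_mul _).sub (hL.right_cont β ⟨hβ.1, h1⟩)
    have hev := hc.eventually (lt_mem_nhds hlt)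
    obtain ⟨δ, hδ, hsub⟩ := mem_nhdsGT_iff_exists_Ioo_subset.1 hev
    rw [Set.mem_Ioi] at hδ
    obtain ⟨k0, hk0⟩ := exists_nat_gt (1 / (δ - β))
    filter_upwards [Filter.eventually_ge_atTop 1, Filter.eventually_ge_atTop k0] with k hk hkk
    have hkpos : (0 : ℝ) < k := by positivity
    have hfl : ⌊β * k⌋₊ < k := by
      rw [Nat.floor_lt (mul_nonneg hβ.1 hkpos.le)]
      nlinarith
    refine ⟨⟨⌊β * k⌋₊, hfl⟩, le_of_lt (hsub ⟨?_, ?_⟩)⟩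
    · rw [lt_div_iff₀ hkpos]
      exact Nat.lt_floor_add_one _
    · rw [div_lt_iff₀ hkpos]
      have h3 : (⌊β * k⌋₊ : ℝ) ≤ β * k := Nat.floor_le (mul_nonneg hβ.1 hkpos.le)
      have h4 : 1 / (δ - β) < k := hk0.trans_le (by exact_mod_cast hkk)
      rw [div_lt_iff₀ (by linarith)] at h4
      nlinarith

theorem effOut_monotoneOn (hK : IsWiretapChannel K) (hG : IsCRDF G) :
    MonotoneOn (effOut K G L) (Set.Icc 0 1) := by
  intro x hx y hy hxy
  have h := hG.mono hx hy hxy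
  exact max_le_max (mul_le_mul_of_nonneg_left h (secrecyCapacity_nonneg hK))
    (sub_le_sub_right (mul_le_mul_of_nonneg_left h (capacity_nonneg hK)) _)

/-- Monotonicity controls the left side and right-continuity the other. Upper semicontinuity is what
makes E(x) - s x attain its maximum. -/
theorem effOut_upperSemicontinuousOn (hK : IsWiretapChannel K) (hG : IsCRDF G) :
    UpperSemicontinuousOn (effOut K G L) (Set.Icc 0 1) := by
  intro x hx y hy
  have hleft : ∀ᶠ z in nhdsWithin x (Set.Icc 0 1 ∩ Set.Iic x), effOut K G L z < y := by
    filter_upwards [self_mem_nhdsWithin] with z hz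
    exact (effOut_monotoneOn hK hG hz.1 hx hz.2).trans_lt hy
  have hright : ∀ᶠ z in nhdsWithin x (Set.Icc 0 1 ∩ Set.Ioi x), effOut K G L z < y := by
    rcases hx.2.eq_or_lt with h1 | h1
    · have : Set.Icc (0 : ℝ) 1 ∩ Set.Ioi x = ∅ := by
        ext z; simp [h1]
      simp [this]
    · have hc : ContinuousWithinAt (effOut K G L) (Set.Ioi x) x :=
        ((hG.right_cont x ⟨hx.1, h1⟩).const_mul _).max
          (((hG.right_cont x ⟨hx.1, h1⟩).const_mul _).sub continuousWithinAt_const)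
      exact (hc.mono Set.inter_subset_right).eventually (gt_mem_nhds hy)
  have := Filter.eventually_sup.2 ⟨hleft, hright⟩
  rw [← nhdsWithin_union, ← Set.inter_union_distrib_left, Set.Iic_union_Ioi, Set.inter_univ]
    at this
  exact this

end Tail
end SeqJSC

namespace SeqJSC

open MeasureTheory

/-! ### The concave envelope and the hinge integrals of its slope. -/

section Envelope

variable {E g : ℝ → ℝ}

/-- The pointwise infimum of all concave majorants; the constant M shows that there are some. -/
theorem exists_concaveEnvelope {M : ℝ} {s : Set ℝ} (hs : Convex ℝ s) (hE : ∀ x ∈ s, E x ≤ M) :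
    ∃ g, IsConcaveEnvelopeOn s E g := by
  let H : Set (ℝ → ℝ) := {h | ConcaveOn ℝ s h ∧ ∀ x ∈ s, E x ≤ h x}
  have hne : H.Nonempty := ⟨fun _ => M, concaveOn_const M hs, hE⟩
  have hbdd : ∀ x ∈ s, BddBelow ((fun h => h x) '' H) := by
    rintro x hx
    refine ⟨E x, ?_⟩
    rintro _ ⟨h, hh, rfl⟩
    exact hh.2 x hx
  refine ⟨fun x => sInf ((fun h => h x) '' H), ⟨⟨hs, ?_⟩, ?_, ?_⟩⟩
  · intro x hx y hy a b ha hb hab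
    refine le_csInf (hne.image _) ?_
    rintro _ ⟨h, hh, rfl⟩
    refine le_trans ?_ (hh.1.2 hx hy ha hb hab)
    simp only [smul_eq_mul]
    gcongr
    · exact csInf_le (hbdd x hx) ⟨h, hh, rfl⟩
    · exact csInf_le (hbdd y hy) ⟨h, hh, rfl⟩
  · intro x hx
    refine le_csInf (hne.image _) ?_
    rintro _ ⟨h, hh, rfl⟩
    exact hh.2 x hx
  · intro h hc hle x hx
    exact csInf_le (hbdd x hx) ⟨h, ⟨hc, hle⟩, rfl⟩

/-- The constant E 1 is a concave majorant, so g is largest at 1, and a concave function with its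
maximum at the right end is non-decreasing. -/
theorem IsConcaveEnvelopeOn.monotoneOn (hg : IsConcaveEnvelopeOn (Set.Icc 0 1) E g)
    (hE : MonotoneOn E (Set.Icc 0 1)) : MonotoneOn g (Set.Icc 0 1) := by
  have h1 : (1 : ℝ) ∈ Set.Icc (0 : ℝ) 1 := Set.right_mem_Icc.2 zero_le_one
  have hmax : ∀ x ∈ Set.Icc (0 : ℝ) 1, g x ≤ g 1 := fun x hx =>
    (hg.least (fun _ => E 1) (concaveOn_const _ (convex_Icc 0 1))
      (fun y hy => hE hy h1 hy.2) x hx).trans (hg.le 1 h1)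
  intro x hx y hy hxy
  have := hg.concave.min_le_of_mem_Icc hx h1 ⟨hxy, hy.2⟩
  rwa [min_eq_left (hmax x hx)] at this

theorem ae_differentiableAt_of_monotoneOn {a b : ℝ} (hg : MonotoneOn g (Set.Icc a b)) :
    ∀ᵐ x ∂volume.restrict (Set.Icc a b), DifferentiableAt ℝ g x ∧ 0 ≤ deriv g x := by
  rw [← restrict_Ioo_eq_restrict_Icc, ae_restrict_iff' measurableSet_Ioo]
  filter_upwards [hg.ae_differentiableWithinAt_of_mem] with x hx hx'
  have hn : Set.Icc a b ∈ nhds x := Icc_mem_nhds hx'.1 hx'.2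
  have hd := (hx ⟨hx'.1.le, hx'.2.le⟩).differentiableAt hn
  refine ⟨hd, ?_⟩
  rw [← derivWithin_of_mem_nhds hn]
  exact hg.derivWithin_nonneg

/-- The hinge functional of the derivative of the concave envelope, bounded by values of the
function itself. -/
theorem IsConcaveEnvelopeOn.exists_hinge_le (hg : IsConcaveEnvelopeOn (Set.Icc 0 1) E g)
    (hE : MonotoneOn E (Set.Icc 0 1)) (husc : UpperSemicontinuousOn E (Set.Icc 0 1)) (s : ℝ) :
    ∃ α ∈ Set.Icc (0 : ℝ) 1,
      ∫ x in Set.Icc (0 : ℝ) 1, max (s - deriv g x) 0 ≤ s * (1 - α) - E 1 + E α := by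
  have hne : (Set.Icc (0 : ℝ) 1).Nonempty := Set.nonempty_Icc.2 zero_le_one
  have husc' : UpperSemicontinuousOn (fun x => E x + (-s * x)) (Set.Icc 0 1) :=
    husc.add (ContinuousOn.upperSemicontinuousOn (by fun_prop))
  -- As α maximizes E x - s x, the line of slope s through (α, E α) lies above E, hence above g, and
  -- g touches E at α.
  obtain ⟨α, hα, hmax⟩ := husc'.exists_isMaxOn hne isCompact_Icc
  refine ⟨α, hα, ?_⟩
  have hline : ∀ x ∈ Set.Icc (0 : ℝ) 1, g x ≤ s * x + (E α - s * α) := by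
    refine hg.least _ ?_ ?_
    · exact ((LinearMap.mulLeft ℝ s).concaveOn (convex_Icc 0 1)).add_const _
    · intro x hx
      have := hmax hx
      simp only [Set.mem_ofPred_eq] at this
      linarith
  have h1 : (1 : ℝ) ∈ Set.Icc (0 : ℝ) 1 := Set.right_mem_Icc.2 zero_le_one
  have h0 : (0 : ℝ) ∈ Set.Icc (0 : ℝ) 1 := Set.left_mem_Icc.2 zero_le_one
  -- f is convex with minimum at α. So the hinge of the slope is almost everywhere 0 to the left of
  -- α and f' to the right.
  let f : ℝ → ℝ := fun x => s * x - g x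
  have hf : ConvexOn ℝ (Set.Icc 0 1) f :=
    ((LinearMap.mulLeft ℝ s).convexOn (convex_Icc 0 1)).sub hg.concave
  have hgα : g α = E α := le_antisymm (by linarith [hline α hα]) (hg.le α hα)
  have hmin : ∀ x ∈ Set.Icc (0 : ℝ) 1, f α ≤ f x := by
    intro x hx
    have := hline x hx
    simp only [f]
    linarith
  have hR : MonotoneOn f (Set.Icc α 1) := by
    intro x hx y hy hxy
    have := hf.le_max_of_mem_Icc hα ⟨hα.1.trans hy.1, hy.2⟩ ⟨hx.1, hxy⟩
    rwa [max_eq_right (hmin y ⟨hα.1.trans hy.1, hy.2⟩)] at this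
  have hL : MonotoneOn (fun x => -f x) (Set.Icc 0 α) := by
    intro x hx y hy hxy
    have := hf.le_max_of_mem_Icc ⟨hx.1, hx.2.trans hα.2⟩ hα ⟨hxy, hy.2⟩
    rw [max_eq_left (hmin x ⟨hx.1, hx.2.trans hα.2⟩)] at this
    exact neg_le_neg this
  have hgd := ae_differentiableAt_of_monotoneOn (hg.monotoneOn hE)
  have hderiv : ∀ x, DifferentiableAt ℝ g x → deriv f x = s - deriv g x := by
    intro x hx
    have := ((hasDerivAt_id x).const_mul s).sub hx.hasDerivAt
    rw [mul_one] at this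
    exact this.deriv
  have hzero : ∀ᵐ x ∂volume.restrict (Set.Icc 0 α), max (s - deriv g x) 0 = 0 := by
    filter_upwards [ae_differentiableAt_of_monotoneOn hL,
      ae_restrict_of_ae_restrict_of_subset (Set.Icc_subset_Icc_right hα.2) hgd] with x hx hx'
    have h2 : deriv (fun x => -f x) x = - deriv f x := deriv.fun_neg
    rw [max_eq_right]
    rw [← hderiv x hx'.1]
    linarith [hx.2]
  have heq : ∀ᵐ x ∂volume.restrict (Set.Icc α 1), max (s - deriv g x) 0 = deriv f x := by
    filter_upwards [ae_differentiableAt_of_monotoneOn hR,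
      ae_restrict_of_ae_restrict_of_subset (Set.Icc_subset_Icc_left hα.1) hgd] with x hx hx'
    rw [← hderiv x hx'.1, max_eq_left hx.2]
  have hR' : MonotoneOn f (Set.uIcc α 1) := by rwa [Set.uIcc_of_le hα.2]
  have hint : IntegrableOn (deriv f) (Set.Icc α 1) :=
    (intervalIntegrable_iff_integrableOn_Icc_of_le hα.2).1 hR'.intervalIntegrable_deriv
  have hI1 : IntegrableOn (fun x => max (s - deriv g x) 0) (Set.Icc α 1) :=
    hint.congr (heq.mono fun x hx => hx.symm)
  have hI0 : IntegrableOn (fun x => max (s - deriv g x) 0) (Set.Icc 0 α) :=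
    (integrable_zero ℝ ℝ (volume.restrict (Set.Icc 0 α))).congr (hzero.mono fun x hx => hx.symm)
  have hsplit : ∫ x in Set.Icc (0 : ℝ) 1, max (s - deriv g x) 0
      = (∫ x in Set.Icc 0 α, max (s - deriv g x) 0) + ∫ x in Set.Icc α 1, max (s - deriv g x) 0 := by
    simp only [integral_Icc_eq_integral_Ioc]
    rw [← Set.Ioc_union_Ioc_eq_Ioc hα.1 hα.2, setIntegral_union (Set.Ioc_disjoint_Ioc_of_le le_rfl)
      measurableSet_Ioc (hI0.mono_set Set.Ioc_subset_Icc_self)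
      (hI1.mono_set Set.Ioc_subset_Icc_self)]
  rw [hsplit, integral_congr_ae hzero, integral_congr_ae heq, integral_zero, zero_add,
    integral_Icc_eq_integral_Ioc, ← intervalIntegral.integral_of_le hα.2]
  -- For monotone f the integral of f' is at most the increment of f; absolute continuity is not
  -- needed.
  have hm := hR'.intervalIntegral_deriv_mem_uIcc
  rw [Set.uIcc_of_le (sub_nonneg.2 (hmin 1 h1))] at hm
  refine hm.2.trans ?_
  have := hg.le 1 h1
  simp only [f, hgα]
  linarith

end Envelope

/-! ### Approximation of convex functions by hinges. -/

section Hinge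

/-- A decreasing convex function is approximated on a grid from below by a positive combination of
hinge functions. -/
theorem exists_hinge_approx {D : ℝ → ℝ} (hconv : ConvexOn ℝ (Set.Ici 0) D)
    (hanti : AntitoneOn D (Set.Ici 0)) {h : ℝ} (hh : 0 < h) {C : (ℝ → ℝ) → Prop}
    (hconst : ∀ c, C fun _ => c)
    (hadd : ∀ F c s, 0 ≤ c → C F → C fun R => F R + c * max (s - R) 0) (M : ℕ) :
    ∀ a : ℝ, 0 ≤ a → ∃ F, C F ∧
      (∃ κ, 0 ≤ κ ∧ κ ≤ (D a - D (a + h)) / h ∧ ∀ R ≤ a, F R = D a + κ * (a - R)) ∧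
      (∀ R, a ≤ R → R ≤ a + M * h → D R ≤ F R ∧ F R ≤ D (max (R - h) a)) ∧
      ∀ R, a + M * h ≤ R → F R = D (a + M * h) := by
  induction M with
  | zero =>
    intro a ha
    refine ⟨fun _ => D a, hconst _, ⟨0, le_rfl, ?_, by simp⟩, ?_, by simp⟩
    · have := hanti (Set.mem_Ici.2 ha) (Set.mem_Ici.2 (by linarith : (0 : ℝ) ≤ a + h)) (by linarith)
      exact div_nonneg (by linarith) hh.le
    · intro R h1 h2
      have : R = a := le_antisymm (by simpa using h2) h1
      subst this
      rw [max_eq_right (by linarith)]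
      exact ⟨le_rfl, le_rfl⟩
  -- F interpolates D linearly on the grid, is constant beyond it, and is built from right to left.
  -- The previous F is affine with slope -κ to the left of a + h; a hinge at a + h with coefficient
  -- κ' - κ changes this to the chord slope -κ'. Convexity gives κ ≤ κ'.
  | succ M ih =>
    intro a ha
    obtain ⟨F, hF, ⟨κ, hκ0, hκ, hlin⟩, hmid, hend⟩ := ih (a + h) (by linarith)
    have m0 : a ∈ Set.Ici (0 : ℝ) := ha
    have m1 : a + h ∈ Set.Ici (0 : ℝ) := Set.mem_Ici.2 (by linarith)
    have m2 : a + h + h ∈ Set.Ici (0 : ℝ) := Set.mem_Ici.2 (by linarith)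
    have hslope : κ ≤ (D a - D (a + h)) / h := by
      refine hκ.trans ?_
      have := hconv.2 m0 m2 (by norm_num : (0 : ℝ) ≤ 1 / 2) (by norm_num : (0 : ℝ) ≤ 1 / 2)
        (by norm_num)
      simp only [smul_eq_mul] at this
      rw [show 1 / 2 * a + 1 / 2 * (a + h + h) = a + h by ring] at this
      gcongr ?_ / _
      linarith
    set κ' := (D a - D (a + h)) / h with hκ'
    have hκ'h : κ' * h = D a - D (a + h) := div_mul_cancel₀ _ hh.ne'
    have hnew : ∀ R ≤ a + h, F R + (κ' - κ) * max (a + h - R) 0 = D a + κ' * (a - R) := by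
      intro R hR
      rw [hlin R hR, max_eq_left (by linarith)]
      linarith
    have hold : ∀ R, a + h ≤ R → F R + (κ' - κ) * max (a + h - R) 0 = F R := by
      intro R hR
      rw [max_eq_right (by linarith)]
      ring
    refine ⟨fun R => F R + (κ' - κ) * max (a + h - R) 0, hadd F _ _ (by linarith) hF,
      ⟨κ', hκ0.trans hslope, le_rfl, fun R hR => hnew R (by linarith)⟩, ?_, ?_⟩
    · intro R h1 h2
      rcases le_total R (a + h) with h3 | h3
      · dsimp only
        rw [hnew R h3, max_eq_right (by linarith)]
        constructor
        · have := hconv.2 m0 m1 (div_nonneg (by linarith) hh.le : 0 ≤ (a + h - R) / h)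
            (div_nonneg (by linarith) hh.le : 0 ≤ (R - a) / h) (by field_simp; ring)
          simp only [smul_eq_mul] at this
          rw [show (a + h - R) / h * a + (R - a) / h * (a + h) = R by field_simp; ring] at this
          refine this.trans (le_of_eq ?_)
          rw [hκ']
          field_simp
          ring
        · nlinarith [hκ0.trans hslope]
      · dsimp only
        rw [hold R h3]
        obtain ⟨h4, h5⟩ := hmid R h3 (by push_cast at h2; linarith)
        refine ⟨h4, h5.trans (hanti (Set.mem_Ici.2 (ha.trans (le_max_right _ _)))
          (Set.mem_Ici.2 (le_trans (by linarith) (le_max_right _ _)))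
          (max_le_max le_rfl (by linarith)))⟩
    · intro R hR
      push_cast at hR ⊢
      have : 0 ≤ (M : ℝ) * h := by positivity
      rw [hold R (by linarith), hend R (by linarith)]
      congr 1
      ring

end Hinge
end SeqJSC

namespace SeqJSC

open Finset MeasureTheory

/-! ### Comparison of the letter rates with the slope of the envelope. -/

section Main

variable {X Y U V Z : Type*} [Fintype X] [Fintype U] [Fintype V] [Fintype Z] {G L g : ℝ → ℝ}
  {p : X → ℝ} {K : U → V × Z → ℝ} {k n : ℕ}

/-- The average of a function of the rates of the source letters. -/
noncomputable def Code.avgRate (c : Code X Y U V G k n) (p : X → ℝ) (K : U → V × Z → ℝ)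
    (F : ℝ → ℝ) : ℝ :=
  (∑ i, ∑ t, F (c.letterRate p K i t)) / (n * k)

/-- The leakage constraint. -/
def Code.IsSecret (c : Code X Y U V G k n) (p : X → ℝ) (K : U → V × Z → ℝ) (L : ℝ → ℝ) : Prop :=
  ∀ i : Fin k, 1 / ((n : ℝ) * k) * c.leakage p K i ≤ L (((i : ℕ) + 1 : ℝ) / k)

theorem card_filter_le_val {m : ℕ} (hm : m ≤ k) :
    (#(univ.filter fun i : Fin k => m ≤ (i : ℕ)) : ℝ) = k - m := by
  have : (univ.filter fun i : Fin k => m ≤ (i : ℕ)).map Fin.valEmbedding = Ico m k := by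
    ext i
    simp only [mem_map, mem_filter, mem_univ, true_and, Fin.valEmbedding_apply, mem_Ico]
    exact ⟨by rintro ⟨j, hj, rfl⟩; exact ⟨hj, j.2⟩, fun h => ⟨⟨i, h.2⟩, h.1, rfl⟩⟩
  rw [← card_map Fin.valEmbedding, this, Nat.card_Ico, Nat.cast_sub hm]

theorem hinge_le_avgRate (hp : p ∈ stdSimplex ℝ X) (hK : IsWiretapChannel K)
    (hG : IsCRDF G) (hL : IsCLDF L) (hg : IsConcaveEnvelopeOn (Set.Icc 0 1) (effOut K G L) g)
    (s : ℝ) {ε : ℝ} (hε : 0 < ε) :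
    ∀ᶠ k : ℕ in Filter.atTop, ∀ n : ℕ, 1 ≤ n → ∀ c : Code X Y U V G k n, c.IsSecret p K L →
      ∫ x in Set.Icc (0 : ℝ) 1, max (s - deriv g x) 0
        ≤ c.avgRate p K (fun R => max (s - R) 0) + ε := by
  obtain ⟨α, hα, hle⟩ := hg.exists_hinge_le (effOut_monotoneOn hK hG)
    (effOut_upperSemicontinuousOn hK hG) s
  obtain ⟨k0, hk0⟩ := exists_nat_gt (|s| / (ε / 2))
  filter_upwards [exists_grid_leakLoss (K := K) hG hL (half_pos hε),
    Filter.eventually_ge_atTop 1, Filter.eventually_ge_atTop k0] with k ⟨j, hj⟩ hk hkk n hn c hc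
  have hkpos : (0 : ℝ) < k := by exact_mod_cast hk
  have hnpos : (0 : ℝ) < n := by exact_mod_cast hn
  -- Rounding α k up keeps E α ≤ E (m/k) by monotonicity, and moves s (1 - α) by at most |s|/k ≤
  -- ε/2. The other ε/2 is spent on the grid point j.
  have hm : ⌈α * k⌉₊ ≤ k := Nat.ceil_le.2 (by nlinarith [hα.2])
  have htail := sum_letterRate_le_effOut hp hK hG hL hk hn c hc (half_pos hε).le j hj hm
  have hm1 : α * k ≤ ⌈α * k⌉₊ := Nat.le_ceil _
  have hm2 : (⌈α * k⌉₊ : ℝ) < α * k + 1 := Nat.ceil_lt_add_one (mul_nonneg hα.1 hkpos.le)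
  generalize ⌈α * k⌉₊ = m at *
  have hEm : effOut K G L α ≤ effOut K G L (m / k) :=
    effOut_monotoneOn hK hG hα (div_mem_Icc hm) (by rwa [le_div_iff₀ hkpos])
  have hsum : n * (k - m) * s
        - ∑ i ∈ univ.filter (fun i : Fin k => m ≤ (i : ℕ)), ∑ t, c.letterRate p K i t
      ≤ ∑ i, ∑ t, max (s - c.letterRate p K i t) 0 := by
    calc _ = ∑ i ∈ univ.filter (fun i : Fin k => m ≤ (i : ℕ)), ∑ t : Fin n,
          (s - c.letterRate p K i t) := by
          simp only [sum_sub_distrib, sum_const, card_univ, Fintype.card_fin, nsmul_eq_mul,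
            card_filter_le_val hm]
          ring
      _ ≤ ∑ i ∈ univ.filter (fun i : Fin k => m ≤ (i : ℕ)), ∑ t : Fin n,
          max (s - c.letterRate p K i t) 0 :=
          sum_le_sum fun i _ => sum_le_sum fun t _ => le_max_left _ _
      _ ≤ _ := sum_le_sum_of_subset_of_nonneg (subset_univ _)
          fun i _ _ => sum_nonneg fun t _ => le_max_right _ _
  have hs : |s| ≤ k * (ε / 2) := by
    rw [div_lt_iff₀ (half_pos hε)] at hk0
    have : (k0 : ℝ) ≤ k := by exact_mod_cast hkk
    nlinarith
  have hround : s * (k * (1 - α)) - k * (ε / 2) ≤ (k - m) * s := by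
    have h1 : |m - α * k| ≤ 1 := by rw [abs_le]; constructor <;> linarith
    have h2 : (m - α * k) * s ≤ |s| := by
      refine (le_abs_self _).trans ?_
      rw [abs_mul]
      nlinarith [abs_nonneg s]
    nlinarith
  refine hle.trans ?_
  rw [Code.avgRate, ← sub_le_iff_le_add, le_div_iff₀ (mul_pos hnpos hkpos)]
  refine le_trans ?_ hsum
  have h3 := mul_le_mul_of_nonneg_left hround hnpos.le
  have h4 := mul_le_mul_of_nonneg_left hEm (mul_pos hnpos hkpos).le
  nlinarith

/-- The functions for which the derivative of the envelope is dominated by the letter rates. -/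
def IsDominated (Y : Type*) (p : X → ℝ) (K : U → V × Z → ℝ) (G L g F : ℝ → ℝ) : Prop :=
  IntegrableOn (fun x => F (deriv g x)) (Set.Icc (0 : ℝ) 1) ∧
  ∀ ε : ℝ, 0 < ε → ∀ᶠ k : ℕ in Filter.atTop, ∀ n : ℕ, 1 ≤ n → ∀ c : Code X Y U V G k n,
    c.IsSecret p K L →
      ∫ x in Set.Icc (0 : ℝ) 1, F (deriv g x) ≤ c.avgRate p K F + ε

omit [Fintype U] in
theorem isDominated_const (C : ℝ) : IsDominated Y p K G L g (fun _ => C) := by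
  refine ⟨integrableOn_const (by simp), fun ε hε => ?_⟩
  filter_upwards [Filter.eventually_ge_atTop 1] with k hk n hn c _
  have hkpos : (0 : ℝ) < k := by exact_mod_cast hk
  have hnpos : (0 : ℝ) < n := by exact_mod_cast hn
  have h1 : c.avgRate p K (fun _ => C) = C := by
    simp only [Code.avgRate, sum_const, card_univ, Fintype.card_fin, nsmul_eq_mul]
    field_simp
  rw [h1]
  simp [hε.le]

theorem IsDominated.add_hinge (hp : p ∈ stdSimplex ℝ X) (hK : IsWiretapChannel K)
    (hG : IsCRDF G) (hL : IsCLDF L) (hg : IsConcaveEnvelopeOn (Set.Icc 0 1) (effOut K G L) g)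
    (F : ℝ → ℝ) (a s : ℝ) (ha : 0 ≤ a) (hF : IsDominated Y p K G L g F) :
    IsDominated Y p K G L g (fun R => F R + a * max (s - R) 0) := by
  have hint : IntegrableOn (fun x => max (s - deriv g x) 0) (Set.Icc (0 : ℝ) 1) := by
    refine Integrable.mono' (g := fun _ => |s|) (integrableOn_const (by simp))
      (((measurable_const.sub (measurable_deriv g)).max measurable_const).aestronglyMeasurable) ?_
    filter_upwards [ae_differentiableAt_of_monotoneOn
      (hg.monotoneOn (effOut_monotoneOn hK hG))] with x hx
    rw [Real.norm_of_nonneg (le_max_right _ _)]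
    exact max_le (by linarith [hx.2, le_abs_self s]) (abs_nonneg s)
  refine ⟨hF.1.add (hint.const_mul a), fun ε hε => ?_⟩
  -- The denominator has a + 1 because a may be 0.
  have hε' : 0 < ε / (2 * (a + 1)) := by positivity
  filter_upwards [hF.2 _ (half_pos hε), hinge_le_avgRate (Y := Y) hp hK hG hL hg s hε'] with
    k h1 h2 n hn c hc
  have h1 := h1 n hn c hc
  have h2 := mul_le_mul_of_nonneg_left (h2 n hn c hc) ha
  have h3 : a * (ε / (2 * (a + 1))) ≤ ε / 2 := by
    rw [← mul_div_assoc, div_le_div_iff₀ (by positivity) (by positivity)]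
    nlinarith
  have e1 : ∫ x in Set.Icc (0 : ℝ) 1, (F (deriv g x) + a * max (s - deriv g x) 0)
      = (∫ x in Set.Icc (0 : ℝ) 1, F (deriv g x))
        + a * ∫ x in Set.Icc (0 : ℝ) 1, max (s - deriv g x) 0 := by
    rw [integral_add hF.1 (hint.const_mul a), integral_const_mul]
  have e2 : c.avgRate p K (fun R => F R + a * max (s - R) 0)
      = c.avgRate p K F + a * c.avgRate p K (fun R => max (s - R) 0) := by
    simp only [Code.avgRate, sum_add_distrib, ← mul_sum]
    ring
  rw [e1, e2]
  linarith

omit [Fintype U] in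
theorem Code.avgRate_le_expectedDistortion (hp : p ∈ stdSimplex ℝ X) (hK : IsWiretapChannel K)
    {d : X → Y → ℝ≥0∞} (hD : ∀ R, distortionRate p d R ≠ ⊤) (hk : 1 ≤ k) (hn : 1 ≤ n)
    (c : Code X Y U V G k n) {r : ℝ} (hr : 0 ≤ r)
    (h : c.expectedDistortion p K d ≤ ENNReal.ofReal r) :
    c.avgRate p K (realDistortionRate p d) ≤ r := by
  have hkpos : (0 : ℝ) < k := by exact_mod_cast hk
  have hnpos : (0 : ℝ) < n := by exact_mod_cast hn
  have h1 := (c.sum_distortionRate_le hp hK d).trans h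
  rw [← ENNReal.ofReal_le_ofReal_iff hr]
  refine le_trans (le_of_eq ?_) h1
  rw [avgRate, div_eq_inv_mul, ENNReal.ofReal_mul (by positivity),
    ENNReal.ofReal_inv_of_pos (by positivity), ENNReal.ofReal_mul hnpos.le,
    ENNReal.ofReal_natCast, ENNReal.ofReal_natCast, ENNReal.ofReal_sum_of_nonneg
    fun i _ => sum_nonneg fun t _ => realDistortionRate_nonneg _]
  congr 1
  refine sum_congr rfl fun i _ => ?_
  rw [ENNReal.ofReal_sum_of_nonneg fun t _ => realDistortionRate_nonneg _]
  exact sum_congr rfl fun t _ => ofReal_realDistortionRate hD _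

/-- The bound with the rate increased by `h`. -/
theorem integral_realDistortionRate_le (hp : p ∈ stdSimplex ℝ X) (hK : IsWiretapChannel K)
    (hG : IsCRDF G) (hL : IsCLDF L) (hg : IsConcaveEnvelopeOn (Set.Icc 0 1) (effOut K G L) g)
    {d : X → Y → ℝ≥0∞} (hD : ∀ R, distortionRate p d R ≠ ⊤) {dbar : ℝ≥0∞} (hdbar : dbar ≠ ⊤)
    (hach : IsAchievable p d K G L dbar) {h : ℝ} (hh : 0 < h) :
    ∫⁻ x in Set.Icc (0 : ℝ) 1, ENNReal.ofReal (realDistortionRate p d (deriv g x + h)) ≤ dbar := by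
  set D := realDistortionRate p d with hDdef
  have hanti : Antitone D := realDistortionRate_antitone hD
  have hnn : ∀ R, 0 ≤ D R := realDistortionRate_nonneg
  -- The shift by h absorbs the interpolation error on a grid of mesh h: F R ≤ D (max (R - h) 0 + h)
  -- ≤ D R on the grid range, without any uniform continuity of D.
  have hconv : ConvexOn ℝ (Set.Ici 0) fun R => D (R + h) :=
    ((realDistortionRate_convexOn hD hp).translate_left h).subset
      (fun x hx => Set.mem_preimage.2 (Set.mem_Ici.2 (by
        have := Set.mem_Ici.1 hx
        linarith))) (convex_Ici 0)
  have hmeas : Measurable fun x => D (deriv g x + h) :=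
    hanti.measurable.comp ((measurable_deriv g).add_const h)
  have hint : IntegrableOn (fun x => D (deriv g x + h)) (Set.Icc (0 : ℝ) 1) := by
    refine Integrable.mono' (g := fun _ => D h) (integrableOn_const (by simp))
      hmeas.aestronglyMeasurable ?_
    filter_upwards [ae_differentiableAt_of_monotoneOn
      (hg.monotoneOn (effOut_monotoneOn hK hG))] with x hx
    rw [Real.norm_of_nonneg (hnn _)]
    exact hanti (by linarith [hx.2])
  rw [← ofReal_integral_eq_lintegral_ofReal hint (Filter.Eventually.of_forall fun x => hnn _)]
  refine ENNReal.ofReal_le_of_le_toReal (le_of_forall_pos_le_add fun ε hε => ?_)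
  have hε3 : 0 < ε / 3 := by positivity
  have hbb : BddBelow (Set.range D) := ⟨0, by rintro _ ⟨R, rfl⟩; exact hnn R⟩
  -- From R₀ on, D is within ε/3 of its infimum, so the approximation may be constant beyond a grid
  -- that passes R₀.
  obtain ⟨_, ⟨R₀, rfl⟩, hR₀⟩ := exists_lt_of_csInf_lt (Set.range_nonempty D)
    (lt_add_of_pos_right (sInf (Set.range D)) hε3)
  obtain ⟨M, hM⟩ := exists_nat_gt (R₀ / h)
  rw [div_lt_iff₀ hh] at hM
  obtain ⟨F, hF, -, hmid, hend⟩ := exists_hinge_approx hconv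
    (fun x _ y _ hxy => hanti (by linarith)) hh (C := IsDominated Y p K G L g)
    isDominated_const (IsDominated.add_hinge hp hK hG hL hg) M 0 le_rfl
  rw [zero_add] at hmid hend
  have hlow : ∀ R, 0 ≤ R → D (R + h) ≤ F R := by
    intro R hR
    rcases le_total R (M * h) with h1 | h1
    · exact (hmid R hR h1).1
    · rw [hend R h1]
      exact hanti (by linarith)
  have hup : ∀ R, 0 ≤ R → F R ≤ D R + ε / 3 := by
    intro R hR
    rcases le_total R (M * h) with h1 | h1
    · have h2 := (hmid R hR h1).2
      have h3 : D (max (R - h) 0 + h) ≤ D R := hanti (by linarith [le_max_left (R - h) 0])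
      linarith
    · rw [hend R h1]
      have h2 : D (M * h + h) ≤ D R₀ := hanti (by linarith)
      have h3 : sInf (Set.range D) ≤ D R := csInf_le hbb ⟨R, rfl⟩
      linarith
  -- First k, from a domination uniform in n and in the code; then the codes for this k; then n,
  -- from the limit superior.
  obtain ⟨k, hk, hdom⟩ := ((Filter.eventually_ge_atTop 1).and (hF.2 _ hε3)).exists
  obtain ⟨c, hlim, hsec⟩ := hach k hk
  have hlt : dbar < ENNReal.ofReal (dbar.toReal + ε / 3) := by
    rw [ENNReal.lt_ofReal_iff_toReal_lt hdbar]
    linarith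
  obtain ⟨n, hn, hdist⟩ := ((Filter.eventually_ge_atTop 1).and
    (Filter.eventually_lt_of_limsup_lt (hlim.trans_lt hlt))).exists
  have h1 := hdom n hn (c n) (hsec n hn)
  have h2 := (c n).avgRate_le_expectedDistortion hp hK hD hk hn
    (add_nonneg ENNReal.toReal_nonneg hε3.le) hdist.le
  have h3 : (c n).avgRate p K F ≤ (c n).avgRate p K D + ε / 3 := by
    have hkpos : (0 : ℝ) < k := by exact_mod_cast hk
    have hnpos : (0 : ℝ) < n := by exact_mod_cast hn
    rw [Code.avgRate, Code.avgRate, div_add' _ _ _ (by positivity)]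
    gcongr
    calc ∑ i, ∑ t, F ((c n).letterRate p K i t)
        ≤ ∑ i, ∑ t, (D ((c n).letterRate p K i t) + ε / 3) := sum_le_sum fun i _ =>
          sum_le_sum fun t _ => hup _ ((c n).letterRate_nonneg hp hK i t)
      _ = _ := by
          simp only [sum_add_distrib, sum_const, card_univ, Fintype.card_fin, nsmul_eq_mul]
          ring
  have h4 : ∫ x in Set.Icc (0 : ℝ) 1, D (deriv g x + h)
      ≤ ∫ x in Set.Icc (0 : ℝ) 1, F (deriv g x) := by
    refine integral_mono_ae hint hF.1 ?_
    filter_upwards [ae_differentiableAt_of_monotoneOn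
      (hg.monotoneOn (effOut_monotoneOn hK hG))] with x hx
    exact hlow _ hx.2
  linarith

/-- Monotone convergence along the shifts h = 1/(m + 1), by right-continuity of the distortion-rate
function. -/
theorem lintegral_distortionRate_le (hp : p ∈ stdSimplex ℝ X) (hK : IsWiretapChannel K)
    (hG : IsCRDF G) (hL : IsCLDF L) (hg : IsConcaveEnvelopeOn (Set.Icc 0 1) (effOut K G L) g)
    {d : X → Y → ℝ≥0∞} (hD : ∀ R, distortionRate p d R ≠ ⊤) {dbar : ℝ≥0∞}
    (hach : IsAchievable p d K G L dbar) :
    ∫⁻ x in Set.Icc (0 : ℝ) 1, distortionRate p d (ENNReal.ofReal (deriv g x)) ≤ dbar := by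
  by_cases hdbar : dbar = ⊤
  · simp [hdbar]
  simp only [fun x => distortionRate_eq_iSup (p := p) (d := d) (ENNReal.ofReal (deriv g x))]
  rw [lintegral_iSup]
  · refine iSup_le fun m => ?_
    refine le_trans (le_of_eq (lintegral_congr_ae ?_)) (integral_realDistortionRate_le hp hK hG hL
      hg hD hdbar hach (h := ((m : ℝ) + 1)⁻¹) (by positivity))
    filter_upwards [ae_differentiableAt_of_monotoneOn
      (hg.monotoneOn (effOut_monotoneOn hK hG))] with x hx
    rw [ofReal_realDistortionRate hD, ENNReal.ofReal_add hx.2 (by positivity),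
      ENNReal.ofReal_inv_of_pos (by positivity), ENNReal.ofReal_add (by positivity) zero_le_one,
      ENNReal.ofReal_natCast, ENNReal.ofReal_one]
  · intro m
    exact distortionRate_antitone.measurable.comp
      ((measurable_deriv g).ennreal_ofReal.add_const _)
  · intro m m' hmm x
    refine distortionRate_antitone (add_le_add_right (ENNReal.inv_le_inv.2 ?_) _)
    gcongr

end Main
end SeqJSC

theorem theorem1 {X Y U V Z : Type*} [Fintype X] [Fintype U] [Fintype V] [Fintype Z]
    (p : X → ℝ) (hp : p ∈ stdSimplex ℝ X)
    (d : X → Y → ℝ≥0∞) (hD : (⨆ R : ℝ≥0∞, SeqJSC.distortionRate p d R) < ⊤)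
    (K : U → V × Z → ℝ) (hK : SeqJSC.IsWiretapChannel K)
    (G L : ℝ → ℝ) (hG : SeqJSC.IsCRDF G) (hL : SeqJSC.IsCLDF L)
    (dbar : ℝ≥0∞) (hach : SeqJSC.IsAchievable p d K G L dbar) :
    (∃ Ghat : ℝ → ℝ,
      SeqJSC.IsConcaveEnvelopeOn (Set.Icc 0 1) (SeqJSC.effOut K G L) Ghat) ∧
    ∀ Ghat : ℝ → ℝ,
      SeqJSC.IsConcaveEnvelopeOn (Set.Icc 0 1) (SeqJSC.effOut K G L) Ghat →
      (∀ᵐ α ∂(MeasureTheory.volume.restrict (Set.Icc (0 : ℝ) 1)),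
        DifferentiableAt ℝ Ghat α ∧ 0 ≤ deriv Ghat α) ∧
      ∫⁻ α in Set.Icc (0 : ℝ) 1,
        SeqJSC.distortionRate p d (ENNReal.ofReal (deriv Ghat α)) ≤ dbar := by
  have hmono := SeqJSC.effOut_monotoneOn (L := L) hK hG
  refine ⟨SeqJSC.exists_concaveEnvelope (convex_Icc 0 1)
    fun x hx => hmono hx (Set.right_mem_Icc.2 zero_le_one) hx.2, fun Ghat hg => ⟨?_, ?_⟩⟩
  · exact SeqJSC.ae_differentiableAt_of_monotoneOn (hg.monotoneOn hmono)
  · exact SeqJSC.lintegral_distortionRate_le hp hK hG hL hg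
      (fun R => ((le_iSup _ R).trans_lt hD).ne) hach
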